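/- **Definitions.** An *increasing tableau* of shape $\lambda$ is a filling of the Young diagram $\lambda$ by positive integers, strictly increasing along rows and down columns, whose set of entries is an initial segment $\{1,\dots,M\}$. Let $\mathrm{Inc}^{\lambda}_k$ be the set of those with $M=|\lambda|-k$, and let $\mathrm{SYT}(\lambda)$ be the set of standard Young tableaux of shape $\lambda$. The SE-neighbors of a box are the boxes of $\lambda$ immediately right of it and immediately below it. *K-promotion* $\mathcal P_K$: delete the entry $1$ from $T$, leaving an empty box. Repeat the following, simultaneously at all empty boxes, until no empty box has an SE-neighbor: each empty box receives the minimal label of its SE-neighbors, and this label is removed from those of its SE-neighbors in which it appears (an empty box without SE-neighbors is unchanged). Finally label all empty boxes $M+1$ and subtract $1$ from all labels. *Ordinary promotion* $\mathcal P$ of a standard Young tableau is defined in the same way with a single hole and ordinary jeu de taquin slides (the smaller of the SE-neighbors slides into the hole). For $j\ge 0$ let $[T]_j$ be the set of boxes of $T$ with label at most $j$. *K-evacuation* $\mathcal E_K(T)$ is the tableau encoded by the chain $([\mathcal P_K^{M-j}(T)]_j)_{0\le j\le M}$, that is, each box is labelled by the least $j$ such that it lies in $[\mathcal P_K^{M-j}(T)]_j$.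 *Ordinary (Schützenberger) evacuation* $\mathcal E(S)$ of a standard Young tableau $S$ is defined in the same way with $\mathcal P$ in place of $\mathcal P_K$. For $T\in\mathrm{Inc}^{2\times n}_k$ let $A$ be the set of numbers that appear twice in $T$, and $B$ the set of numbers that appear in the second row immediately right of an element of $A$. Let $\mathcal F(T)$ be obtained by deleting the elements of $A$ from the first row of $T$ and the elements of $B$ from the second row (closing the gaps), and appending $B$, in increasing order, to the bottom of the first column. **Proposition.** Let $n,k\ge 0$ be integers. If $k<n$, then $\mathcal F$ is a bijection from $\mathrm{Inc}^{2\times n}_k$ onto $\mathrm{SYT}(n-k,n-k,1^k)$. For every $T\in\mathrm{Inc}^{2\times n}_k$, the tableau $\mathcal E_K(T)$ again lies in $\mathrm{Inc}^{2\times n}_k$, and $$\mathcal E(\mathcal F(T))=\mathcal E_K(\mathcal F(T))=\mathcal F(\mathcal E_K(T)).$$ -/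

import Mathlib

namespace IncTableau

/-- A filling of boxes by natural numbers. Boxes are `(row, column)`, numbered from `0` in English
convention. Tableaux of shape `μ` have positive labels on `μ` and are required to be `0` outside
`μ`, so that two tableaux of the same shape are equal iff they are equal as functions. While labels
are being moved around, the label `0` on a box of `μ` means that this box is empty. -/
abbrev Filling : Type := ℕ × ℕ → ℕ

/-- The largest label of a filling of `μ` (`0` for the empty shape). -/
def maxEntry (μ : YoungDiagram) (T : Filling) : ℕ := μ.cells.sup T

/-- Rows and columns of `T` are strictly increasing along `μ`. -/
def IsStrict (μ : YoungDiagram) (T : Filling) : Prop :=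
  (∀ r c₁ c₂, c₁ < c₂ → (r, c₂) ∈ μ → T (r, c₁) < T (r, c₂)) ∧
  (∀ r₁ r₂ c, r₁ < r₂ → (r₂, c) ∈ μ → T (r₁, c) < T (r₂, c))

/-- Increasing tableaux of shape `μ` with maximum value `|μ| - k`: rows and columns are strictly
increasing and the set of labels is an initial segment `{1, …, M}` of the positive integers, with
`M + k = |μ|`. -/
def Inc (μ : YoungDiagram) (k : ℕ) : Set Filling :=
  {T | (∀ b, b ∉ μ → T b = 0) ∧ IsStrict μ T ∧
    μ.cells.image T = Finset.Icc 1 (maxEntry μ T) ∧ maxEntry μ T + k = μ.card}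

/-- Standard Young tableaux of shape `μ`: rows and columns are strictly increasing and each of
`1, …, |μ|` is used exactly once. -/
def SYT (μ : YoungDiagram) : Set Filling :=
  {T | (∀ b, b ∉ μ → T b = 0) ∧ IsStrict μ T ∧
    Set.BijOn T (μ.cells : Set (ℕ × ℕ)) (Set.Icc 1 μ.card)}

/-- The rectangle with `m` rows and `n` columns. -/
def rect (m n : ℕ) : YoungDiagram where
  cells := Finset.range m ×ˢ Finset.range n
  isLowerSet := by
    rintro ⟨r, c⟩ ⟨r', c'⟩ ⟨hr, hc⟩ h
    simp only [Finset.coe_product, Finset.coe_range, Set.mem_prod, Set.mem_Iio] at h hr hc ⊢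
    exact ⟨lt_of_le_of_lt hr h.1, lt_of_le_of_lt hc h.2⟩

/-- The flag shape `(n - k, n - k, 1ᵏ)`: two rows of length `n - k`, followed by `k` rows of
length `1`. It is meant for `k < n` (and is empty for `n ≤ k`). -/
def flagShape (n k : ℕ) : YoungDiagram where
  cells := (Finset.range (k + 2) ×ˢ Finset.range (n - k)).filter fun b => b.1 < 2 ∨ b.2 = 0
  isLowerSet := by
    rintro ⟨r, c⟩ ⟨r', c'⟩ ⟨hr, hc⟩ h
    simp only [Finset.coe_filter, Finset.mem_product, Finset.mem_range, Set.mem_ofPred_eq]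
      at h hr hc ⊢
    omega

/-- The flag shape has the row lengths it should have. -/
theorem rowLen_flagShape (n k r : ℕ) (hk : k < n) :
    (flagShape n k).rowLen r = if r < 2 then n - k else if r < k + 2 then 1 else 0 := by
  have key : ∀ c, c < (flagShape n k).rowLen r ↔
      c < if r < 2 then n - k else if r < k + 2 then 1 else 0 := by
    intro c
    rw [← YoungDiagram.mem_iff_lt_rowLen, ← YoungDiagram.mem_cells]
    simp only [flagShape, Finset.mem_filter, Finset.mem_product, Finset.mem_range]
    split_ifs <;> omega
  exact le_antisymm (not_lt.1 fun h => lt_irrefl _ ((key _).1 h))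
    (not_lt.1 fun h => lt_irrefl _ ((key _).2 h))

/-! ### K-promotion and ordinary promotion -/

/-- The boxes of `μ` immediately right of or immediately below `b`. -/
def seNeighbors (μ : YoungDiagram) (b : ℕ × ℕ) : Finset (ℕ × ℕ) :=
  ({(b.1, b.2 + 1), (b.1 + 1, b.2)} : Finset (ℕ × ℕ)).filter (· ∈ μ)

/-- The minimal label of the SE-neighbors of `b`, or `0` (empty) if there are none. -/
def minLabel (μ : YoungDiagram) (T : Filling) (b : ℕ × ℕ) : ℕ :=
  if h : (seNeighbors μ b).Nonempty then (seNeighbors μ b).inf' h T else 0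

/-- One step of K-jeu de taquin, performed simultaneously at all empty boxes: each empty box
receives the minimal label of its SE-neighbors (and stays empty if it has none), and that label is
removed from the SE-neighbors in which it appears. -/
def kStep (μ : YoungDiagram) (T : Filling) : Filling := fun b =>
  if b ∈ μ ∧ T b = 0 then minLabel μ T b
  else if ∃ e ∈ μ.cells, T e = 0 ∧ b ∈ seNeighbors μ e ∧ T b = minLabel μ T e then 0
  else T b

/-- Delete the label `1`. -/
def deleteOne (T : Filling) : Filling := fun b => if T b = 1 then 0 else T b

/-- Label all empty boxes of `μ` by `M + 1`, then subtract one from every label. -/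
def fillAndShift (μ : YoungDiagram) (M : ℕ) (T : Filling) : Filling := fun b =>
  if b ∈ μ then (if T b = 0 then M + 1 else T b) - 1 else 0

/-- K-promotion. In each step the empty boxes that have an SE-neighbor move one antidiagonal
further, so after `|μ|` steps no empty box has an SE-neighbor, and then `kStep` changes nothing. -/
def kPromotion (μ : YoungDiagram) (T : Filling) : Filling :=
  fillAndShift μ (maxEntry μ T) ((kStep μ)^[μ.card] (deleteOne T))

/-- One step of ordinary jeu de taquin on a filling with one hole `p.2`: the smaller of the labels
immediately right of and immediately below the hole slides into it. Nothing happens if the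
hole has neither neighbor in `μ`. -/
def slideStep (μ : YoungDiagram) (p : Filling × (ℕ × ℕ)) : Filling × (ℕ × ℕ) :=
  let R : ℕ × ℕ := (p.2.1, p.2.2 + 1)
  let D : ℕ × ℕ := (p.2.1 + 1, p.2.2)
  if R ∈ μ ∧ (D ∉ μ ∨ p.1 R < p.1 D) then
    (Function.update (Function.update p.1 p.2 (p.1 R)) R 0, R)
  else if D ∈ μ then
    (Function.update (Function.update p.1 p.2 (p.1 D)) D 0, D)
  else p

/-- Ordinary (Schützenberger) promotion of standard Young tableaux: delete the label `1`, which is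
in the corner box `(0, 0)`, slide the resulting hole outwards as far as possible (this takes fewer
than `|μ|` steps), label it by `M + 1`, and subtract one from every label. -/
def promotion (μ : YoungDiagram) (T : Filling) : Filling :=
  fillAndShift μ (maxEntry μ T) ((slideStep μ)^[μ.card] (deleteOne T, (0, 0))).1

/-! ### K-evacuation and ordinary evacuation -/

/-- `[T]_j`: the boxes of `μ` whose label in `T` is at most `j`. -/
def sublevel (μ : YoungDiagram) (T : Filling) (j : ℕ) : Finset (ℕ × ℕ) :=
  μ.cells.filter fun b => T b ≤ j

/-- The tableau encoded by the chain `([P^(M - j) T]_j)`, `0 ≤ j ≤ M`, where `M` is the maximal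
label of `T`: a box is labelled by the least `j` for which it belongs to the `j`th member of the
chain (boxes outside `μ` belong to no member, and get `sInf ∅ = 0`). -/
noncomputable def evacuationVia (P : Filling → Filling) (μ : YoungDiagram) (T : Filling) :
    Filling := fun b =>
  sInf {j | j ≤ maxEntry μ T ∧ b ∈ sublevel μ (P^[maxEntry μ T - j] T) j}

/-- K-evacuation of increasing tableaux of shape `μ`. -/
noncomputable def kEvacuation (μ : YoungDiagram) : Filling → Filling :=
  evacuationVia (kPromotion μ) μ

/-- Ordinary (Schützenberger) evacuation of standard Young tableaux of shape `μ`. -/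
noncomputable def evacuation (μ : YoungDiagram) : Filling → Filling :=
  evacuationVia (promotion μ) μ

/-! ### The map to flag-shaped standard Young tableaux -/

/-- Row `r` of a filling with `n` columns, as a list. -/
def rowList (n : ℕ) (T : Filling) (r : ℕ) : List ℕ := (List.range n).map fun c => T (r, c)

/-- The set `A` of numbers that appear in both rows of a two-row filling. -/
def setA (n : ℕ) (T : Filling) : Finset ℕ :=
  (rowList n T 0).toFinset ∩ (rowList n T 1).toFinset

/-- The set `B` of numbers that appear in the second row immediately right of an element of `A`. -/
def setB (n : ℕ) (T : Filling) : Finset ℕ :=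
  ((Finset.range n).filter fun c => c + 1 < n ∧ T (1, c) ∈ setA n T).image fun c => T (1, c + 1)

/-- Delete all elements of `A` from the first row of `T` and all elements of `B` from the second
row (closing the gaps), and append `B`, in increasing order, to the first column. -/
def flagMap (n : ℕ) (T : Filling) : Filling := fun b =>
  if b.1 = 0 then ((rowList n T 0).filter (· ∉ setA n T)).getD b.2 0
  else if b.1 = 1 then ((rowList n T 1).filter (· ∉ setB n T)).getD b.2 0
  else if b.2 = 0 then ((setB n T).sort (· ≤ ·)).getD (b.1 - 2) 0
  else 0

end IncTableau

open IncTableau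

/-!
Record an increasing tableau by its arm counts, the row lengths (and the leg length) of the shapes
of its sublevel sets. The arm counts of the iterated K-promotions of a tableau form a triangular
growth diagram whose top row belongs to the tableau, whose right column belongs to its
K-evacuation, and in which any three corners of a unit square determine the fourth by a local rule.
So it suffices to exhibit one array that has the given top row and satisfies the local rule.

For a two-row rectangle such an array is given by minima of the height function of the lattice path
of the tableau; on the right column these minima vanish, and K-evacuation turns out to be rotation
by 180°. For the flag shape, deleting the numbers of `A` and moving those of `B` changes each entry
of that array only by the number of repeated labels in the interval it stands for, up to a
correction at each end. At the right end of the interval `[0, v]` the correction says whether the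
number that follows the last one in the second row is going to be in `B`; the correction at the
left end is the same thing for the rotated tableau. Hence the right column of the flag diagram
belongs to the flag tableau of the rotated rectangle.

On arm counts the map to flag tableaux is inverted by reading the correction off the next label
that is not in the first row.
-/

namespace IncTableau

section Neighbors

variable {μ : YoungDiagram} {T : Filling} {b e : ℕ × ℕ}

theorem mem_seNeighbors :
    b ∈ seNeighbors μ e ↔ (b = (e.1, e.2 + 1) ∨ b = (e.1 + 1, e.2)) ∧ b ∈ μ := by
  simp [seNeighbors]

theorem antidiagonal_of_mem_seNeighbors (h : b ∈ seNeighbors μ e) :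
    b.1 + b.2 = e.1 + e.2 + 1 := by
  rcases mem_seNeighbors.1 h with ⟨rfl | rfl, -⟩ <;> dsimp only <;> omega

theorem mem_of_mem_seNeighbors (h : b ∈ seNeighbors μ e) : b ∈ μ :=
  (mem_seNeighbors.1 h).2

theorem source_mem_of_mem_seNeighbors (h : b ∈ seNeighbors μ e) : e ∈ μ := by
  rcases mem_seNeighbors.1 h with ⟨rfl | rfl, hb⟩
  · exact μ.up_left_mem le_rfl (Nat.le_succ _) hb
  · exact μ.up_left_mem (Nat.le_succ _) le_rfl hb

theorem minLabel_congr {T' : Filling} (h : ∀ b ∈ seNeighbors μ e, T b = T' b) :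
    minLabel μ T e = minLabel μ T' e := by
  unfold minLabel
  split_ifs with hne
  · exact Finset.inf'_congr hne rfl h
  · rfl

theorem minLabel_eq_zero (h : seNeighbors μ e = ∅) : minLabel μ T e = 0 := by
  simp [minLabel, h]

theorem minLabel_le (h : b ∈ seNeighbors μ e) : minLabel μ T e ≤ T b := by
  rw [minLabel, dif_pos ⟨b, h⟩]
  exact Finset.inf'_le T h

theorem exists_eq_minLabel (h : (seNeighbors μ e).Nonempty) :
    ∃ b ∈ seNeighbors μ e, T b = minLabel μ T e := by
  obtain ⟨b, hb, hmin⟩ := Finset.exists_mem_eq_inf' h T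
  exact ⟨b, hb, by rw [minLabel, dif_pos h, hmin]⟩

theorem antidiagonal_lt_card (hb : b ∈ μ) : b.1 + b.2 < μ.card := by
  have hsurj : Set.SurjOn (fun x : ℕ × ℕ => x.1 + x.2) μ.cells
      (Finset.range (b.1 + b.2 + 1)) := by
    intro t ht
    rw [Finset.coe_range, Set.mem_Iio] at ht
    exact ⟨(min t b.1, t - b.1), μ.up_left_mem (by omega) (by omega) hb, by dsimp only; omega⟩
  simpa using Finset.card_le_card_of_surjOn _ hsurj

end Neighbors

/-! ### Increasing tableaux with a given set of labels -/

/-- `T` is an increasing tableau of shape `μ` with set of labels `{1, …, M}`. Strictness is only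
required between adjacent boxes. -/
structure IsIncreasing (μ : YoungDiagram) (M : ℕ) (T : Filling) : Prop where
  eq_zero : ∀ b ∉ μ, T b = 0
  lt : ∀ e, ∀ b ∈ seNeighbors μ e, T e < T b
  pos : ∀ b ∈ μ, 0 < T b
  le : ∀ b ∈ μ, T b ≤ M
  exists_eq : ∀ v, 0 < v → v ≤ M → ∃ b ∈ μ, T b = v

section IsIncreasing

variable {μ : YoungDiagram} {M : ℕ} {T : Filling} {b e : ℕ × ℕ}

theorem isStrict_iff_seNeighbors :
    IsStrict μ T ↔ ∀ e, ∀ b ∈ seNeighbors μ e, T e < T b := by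
  constructor
  · rintro ⟨hrow, hcol⟩ e b hb
    rcases mem_seNeighbors.1 hb with ⟨rfl | rfl, hbμ⟩
    · exact hrow _ _ _ (Nat.lt_succ_self _) hbμ
    · exact hcol _ _ _ (Nat.lt_succ_self _) hbμ
  · intro h
    refine ⟨fun r c₁ c₂ hc hμ => ?_, fun r₁ r₂ c hr hμ => ?_⟩
    · induction c₂, hc using Nat.le_induction with
      | base => exact h (r, c₁) _ (mem_seNeighbors.2 ⟨.inl rfl, hμ⟩)
      | succ c _ ih =>
        exact lt_trans (ih (μ.up_left_mem le_rfl c.le_succ hμ))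
          (h (r, c) _ (mem_seNeighbors.2 ⟨.inl rfl, hμ⟩))
    · induction r₂, hr using Nat.le_induction with
      | base => exact h (r₁, c) _ (mem_seNeighbors.2 ⟨.inr rfl, hμ⟩)
      | succ r _ ih =>
        exact lt_trans (ih (μ.up_left_mem r.le_succ le_rfl hμ))
          (h (r, c) _ (mem_seNeighbors.2 ⟨.inr rfl, hμ⟩))

theorem IsIncreasing.maxEntry_eq (hT : IsIncreasing μ M T) : maxEntry μ T = M := by
  refine le_antisymm (Finset.sup_le fun b hb => hT.le b hb) ?_
  rcases Nat.eq_zero_or_pos M with rfl | hM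
  · exact Nat.zero_le _
  · obtain ⟨b, hb, hbM⟩ := hT.exists_eq M hM le_rfl
    exact hbM ▸ Finset.le_sup (f := T) hb

theorem isIncreasing_maxEntry {k : ℕ} (hT : T ∈ Inc μ k) : IsIncreasing μ (maxEntry μ T) T := by
  obtain ⟨hzero, hstrict, himage, -⟩ := hT
  have hmem : ∀ b ∈ μ, T b ∈ Finset.Icc 1 (maxEntry μ T) := fun b hb =>
    himage ▸ Finset.mem_image_of_mem T hb
  refine ⟨hzero, isStrict_iff_seNeighbors.1 hstrict, fun b hb => (Finset.mem_Icc.1 (hmem b hb)).1,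
    fun b hb => (Finset.mem_Icc.1 (hmem b hb)).2, fun v hv hvM => ?_⟩
  have : v ∈ μ.cells.image T := himage ▸ Finset.mem_Icc.2 ⟨hv, hvM⟩
  simpa using this

theorem mem_inc_iff {k : ℕ} (hM : M + k = μ.card) : T ∈ Inc μ k ↔ IsIncreasing μ M T := by
  constructor
  · intro hT
    obtain rfl : maxEntry μ T = M := by have := hT.2.2.2; omega
    exact isIncreasing_maxEntry hT
  · intro hT
    refine ⟨hT.eq_zero, isStrict_iff_seNeighbors.2 hT.lt, ?_, by rw [hT.maxEntry_eq, hM]⟩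
    ext v
    rw [hT.maxEntry_eq, Finset.mem_image, Finset.mem_Icc]
    exact ⟨fun ⟨b, hb, hbv⟩ => hbv ▸ ⟨hT.pos b hb, hT.le b hb⟩, fun hv => hT.exists_eq v hv.1 hv.2⟩

theorem IsIncreasing.injOn (hT : IsIncreasing μ μ.card T) : Set.InjOn T μ.cells := by
  refine Finset.injOn_of_surjOn_of_card_le T (t := Finset.Icc 1 μ.card)
    (fun b hb => Finset.mem_coe.2 (Finset.mem_Icc.2 ⟨hT.pos b hb, hT.le b hb⟩))
    (fun v hv => ?_) (by simp)
  obtain ⟨hv, hvM⟩ := Finset.mem_Icc.1 hv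
  exact hT.exists_eq v hv hvM

theorem mem_SYT_iff : T ∈ SYT μ ↔ IsIncreasing μ μ.card T := by
  constructor
  · rintro ⟨hzero, hstrict, hbij⟩
    exact ⟨hzero, isStrict_iff_seNeighbors.1 hstrict, fun b hb => (hbij.mapsTo hb).1,
      fun b hb => (hbij.mapsTo hb).2, fun v hv hvM => hbij.surjOn ⟨hv, hvM⟩⟩
  · intro hT
    exact ⟨hT.eq_zero, isStrict_iff_seNeighbors.2 hT.lt,
      fun b hb => ⟨hT.pos b hb, hT.le b hb⟩, hT.injOn, fun v hv => hT.exists_eq v hv.1 hv.2⟩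

theorem IsIncreasing.eq_one_iff (hT : IsIncreasing μ M T) (hb : b ∈ μ) :
    T b = 1 ↔ b = (0, 0) := by
  constructor
  · intro h1
    obtain ⟨r, c⟩ := b
    rcases c with _ | c
    · rcases r with _ | r
      · rfl
      · have : T (r, 0) < T (r + 1, 0) := hT.lt _ _ (mem_seNeighbors.2 ⟨.inr rfl, hb⟩)
        have := hT.pos (r, 0) (μ.up_left_mem r.le_succ le_rfl hb)
        omega
    · have : T (r, c) < T (r, c + 1) := hT.lt _ _ (mem_seNeighbors.2 ⟨.inl rfl, hb⟩)
      have := hT.pos (r, c) (μ.up_left_mem le_rfl c.le_succ hb)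
      omega
  · rintro rfl
    obtain ⟨⟨r, c⟩, hrc, h1⟩ :=
      hT.exists_eq 1 Nat.one_pos ((hT.pos _ hb).trans_le (hT.le _ hb))
    obtain ⟨hrow, hcol⟩ := isStrict_iff_seNeighbors.2 hT.lt
    have hpos := hT.pos _ hb
    rcases Nat.eq_zero_or_pos c with rfl | hc
    · rcases Nat.eq_zero_or_pos r with rfl | hr
      · exact h1
      · have := hcol 0 r 0 hr hrc
        omega
    · have := hT.pos (r, 0) (μ.up_left_mem le_rfl (Nat.zero_le _) hrc)
      have := hrow r 0 c hc hrc
      omega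

end IsIncreasing

/-! ### The holes of K-jeu de taquin -/

/-- The boxes that are empty at some time during K-jeu de taquin, started at the corner. -/
inductive IsHole (μ : YoungDiagram) (T : Filling) : ℕ × ℕ → Prop
  | corner : (0, 0) ∈ μ → IsHole μ T (0, 0)
  | slide {e b : ℕ × ℕ} : IsHole μ T e → b ∈ seNeighbors μ e → T b = minLabel μ T e → IsHole μ T b

open Classical in
/-- The filling after `t` steps of K-jeu de taquin: the holes on the first `t` antidiagonals have
been filled, and the holes on antidiagonal `t` are empty. -/
noncomputable def jdtState (μ : YoungDiagram) (T : Filling) (t : ℕ) : Filling := fun b =>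
  if IsHole μ T b ∧ b.1 + b.2 < t then minLabel μ T b
  else if IsHole μ T b ∧ b.1 + b.2 = t then 0 else T b

section Holes

variable {μ : YoungDiagram} {M t : ℕ} {T : Filling} {b e : ℕ × ℕ}

theorem IsHole.mem (h : IsHole μ T b) : b ∈ μ := by
  cases h with
  | corner h => exact h
  | slide _ h _ => exact mem_of_mem_seNeighbors h

theorem jdtState_of_lt (h : t < b.1 + b.2) : jdtState μ T t b = T b := by
  rw [jdtState, if_neg (by omega), if_neg (by omega)]

theorem jdtState_of_not_isHole (h : ¬ IsHole μ T b) : jdtState μ T t b = T b := by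
  rw [jdtState, if_neg (by tauto), if_neg (by tauto)]

theorem IsHole.jdtState_eq_zero (h : IsHole μ T b) (ht : b.1 + b.2 = t) :
    jdtState μ T t b = 0 := by
  rw [jdtState, if_neg (by omega), if_pos ⟨h, ht⟩]

theorem IsHole.jdtState_eq_minLabel (h : IsHole μ T b) (ht : b.1 + b.2 < t) :
    jdtState μ T t b = minLabel μ T b := by
  rw [jdtState, if_pos ⟨h, ht⟩]

theorem isHole_of_jdtState_eq_zero (hpos : ∀ b ∈ μ, 0 < T b) (he : e ∈ μ)
    (h0 : jdtState μ T t e = 0) :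
    IsHole μ T e ∧ (e.1 + e.2 = t ∨ e.1 + e.2 < t ∧ seNeighbors μ e = ∅) := by
  have hTe := (hpos e he).ne'
  by_cases hole : IsHole μ T e
  · refine ⟨hole, ?_⟩
    rcases lt_trichotomy (e.1 + e.2) t with h | h | h
    · refine .inr ⟨h, Finset.not_nonempty_iff_eq_empty.1 fun hne => ?_⟩
      obtain ⟨b, hb, hmin⟩ := exists_eq_minLabel (T := T) hne
      rw [hole.jdtState_eq_minLabel h, ← hmin] at h0
      exact (hpos b (mem_of_mem_seNeighbors hb)).ne' h0
    · exact .inl h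
    · exact absurd ((jdtState_of_lt h).symm.trans h0) hTe
  · exact absurd ((jdtState_of_not_isHole hole).symm.trans h0) hTe

theorem minLabel_jdtState (ht : e.1 + e.2 = t) :
    minLabel μ (jdtState μ T t) e = minLabel μ T e :=
  minLabel_congr fun b hb => jdtState_of_lt (by have := antidiagonal_of_mem_seNeighbors hb; omega)

theorem kStep_jdtState (hpos : ∀ b ∈ μ, 0 < T b) (t : ℕ) :
    kStep μ (jdtState μ T t) = jdtState μ T (t + 1) := by
  funext b
  unfold kStep
  split_ifs with hempty hslide
  · obtain ⟨hole, ht | ⟨ht, hnone⟩⟩ := isHole_of_jdtState_eq_zero hpos hempty.1 hempty.2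
    · rw [minLabel_jdtState ht, hole.jdtState_eq_minLabel (by omega)]
    · rw [hole.jdtState_eq_minLabel (by omega), minLabel_eq_zero hnone, minLabel_eq_zero hnone]
  · obtain ⟨e, heμ, he0, hbe, hbmin⟩ := hslide
    obtain ⟨hole, ht | ⟨-, hnone⟩⟩ := isHole_of_jdtState_eq_zero hpos heμ he0
    · have hdiag := antidiagonal_of_mem_seNeighbors hbe
      rw [minLabel_jdtState ht, jdtState_of_lt (by omega)] at hbmin
      rw [(hole.slide hbe hbmin).jdtState_eq_zero (by omega)]
    · simp [hnone] at hbe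
  · by_cases hole : IsHole μ T b
    · rcases lt_trichotomy (b.1 + b.2) t with h | h | h
      · rw [hole.jdtState_eq_minLabel h, hole.jdtState_eq_minLabel (by omega)]
      · exact absurd ⟨hole.mem, hole.jdtState_eq_zero h⟩ hempty
      · have hnext : b.1 + b.2 ≠ t + 1 := by
          intro h'
          cases hole with
          | corner _ => simp at h'
          | @slide e _ he hbe hbmin =>
            have hdiag := antidiagonal_of_mem_seNeighbors hbe
            refine hslide ⟨e, he.mem, he.jdtState_eq_zero (by omega), hbe, ?_⟩
            rw [minLabel_jdtState (by omega), jdtState_of_lt h, hbmin]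
        rw [jdtState_of_lt h, jdtState_of_lt (by omega)]
    · rw [jdtState_of_not_isHole hole, jdtState_of_not_isHole hole]

theorem deleteOne_eq_jdtState (hT : IsIncreasing μ M T) : deleteOne T = jdtState μ T 0 := by
  funext b
  by_cases hb : b = (0, 0) ∧ b ∈ μ
  · obtain ⟨rfl, hμ⟩ := hb
    rw [(IsHole.corner hμ).jdtState_eq_zero (t := 0) rfl, deleteOne,
      if_pos ((hT.eq_one_iff hμ).2 rfl)]
  · have h1 : T b ≠ 1 := by
      intro h1
      by_cases hμ : b ∈ μ
      · exact hb ⟨(hT.eq_one_iff hμ).1 h1, hμ⟩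
      · rw [hT.eq_zero b hμ] at h1
        omega
    rw [deleteOne, if_neg h1]
    by_cases hdiag : 0 < b.1 + b.2
    · rw [jdtState_of_lt hdiag]
    · rw [jdtState_of_not_isHole]
      exact fun hole => hb ⟨Prod.ext (by dsimp only; omega) (by dsimp only; omega), hole.mem⟩

theorem kStep_iterate_deleteOne (hT : IsIncreasing μ M T) (t : ℕ) :
    (kStep μ)^[t] (deleteOne T) = jdtState μ T t := by
  induction t with
  | zero => exact deleteOne_eq_jdtState hT
  | succ t ih => rw [Function.iterate_succ_apply', ih, kStep_jdtState hT.pos]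

open Classical in
theorem kPromotion_add_one (hT : IsIncreasing μ M T) (hb : b ∈ μ) :
    kPromotion μ T b + 1 =
      if IsHole μ T b then if (seNeighbors μ b).Nonempty then minLabel μ T b else M + 1
      else T b := by
  have hTb := hT.pos b hb
  rw [kPromotion, kStep_iterate_deleteOne hT, fillAndShift, if_pos hb, hT.maxEntry_eq]
  split_ifs with h0 hole hne hole hne
  · obtain ⟨e, he, hmin⟩ := exists_eq_minLabel (T := T) hne
    have := hT.pos e (mem_of_mem_seNeighbors he)
    rw [hole.jdtState_eq_minLabel (antidiagonal_lt_card hb)] at h0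
    omega
  · omega
  · rw [jdtState_of_not_isHole hole] at h0
    omega
  · rw [hole.jdtState_eq_minLabel (antidiagonal_lt_card hb)] at h0 ⊢
    omega
  · exact absurd ((hole.jdtState_eq_minLabel (antidiagonal_lt_card hb)).trans
      (minLabel_eq_zero (Finset.not_nonempty_iff_eq_empty.1 hne))) h0
  · rw [jdtState_of_not_isHole hole]
    omega

end Holes

/-- The hole of K-jeu de taquin occupies `b` when exactly the labels `≤ v` have been slid past. The
boxes with this property are those in which a chain of sublevel sets of `T` differs from the one of
its K-promotion. -/
def IsHoleAt (μ : YoungDiagram) (T : Filling) (v : ℕ) (b : ℕ × ℕ) : Prop :=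
  IsHole μ T b ∧ T b ≤ v ∧ ∀ b' ∈ seNeighbors μ b, v < T b'

section IsHoleAt

variable {μ : YoungDiagram} {M v : ℕ} {T : Filling} {b : ℕ × ℕ}

theorem kPromotion_le_iff (hT : IsIncreasing μ M T) (hb : b ∈ μ) (hv : v < M) :
    kPromotion μ T b ≤ v ↔ T b ≤ v + 1 ∧ ¬ IsHoleAt μ T (v + 1) b := by
  have hP := kPromotion_add_one hT hb
  by_cases hole : IsHole μ T b
  · rw [if_pos hole] at hP
    by_cases hne : (seNeighbors μ b).Nonempty
    · rw [if_pos hne] at hP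
      constructor
      · intro hle
        obtain ⟨b', hb', hmin⟩ := exists_eq_minLabel (T := T) hne
        have := hT.lt b b' hb'
        refine ⟨by omega, fun hat => ?_⟩
        have := hat.2.2 b' hb'
        omega
      · rintro ⟨hle, hat⟩
        obtain ⟨b', hb', hle'⟩ : ∃ b' ∈ seNeighbors μ b, T b' ≤ v + 1 := by
          by_contra! hall
          exact hat ⟨hole, hle, hall⟩
        have := minLabel_le (T := T) hb'
        omega
    · rw [if_neg hne] at hP
      refine ⟨fun hle => by omega, fun ⟨hle, hat⟩ => absurd ⟨hole, hle, fun b' hb' => ?_⟩ hat⟩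
      exact absurd ⟨b', hb'⟩ hne
  · rw [if_neg hole] at hP
    exact ⟨fun hle => ⟨by omega, fun hat => hole hat.1⟩, fun ⟨_, _⟩ => by omega⟩

theorem isHoleAt_one (hT : IsIncreasing μ M T) : IsHoleAt μ T 1 b ↔ b = (0, 0) ∧ b ∈ μ := by
  constructor
  · rintro ⟨hole, hle, -⟩
    have := hT.pos b hole.mem
    exact ⟨(hT.eq_one_iff hole.mem).1 (by omega), hole.mem⟩
  · rintro ⟨rfl, hb⟩
    have h1 := (hT.eq_one_iff hb).2 rfl
    exact ⟨.corner hb, h1.le, fun b' hb' => h1 ▸ hT.lt _ _ hb'⟩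

theorem isHoleAt_succ (hT : IsIncreasing μ M T) (hv : 1 ≤ v) :
    IsHoleAt μ T (v + 1) b ↔
      (IsHoleAt μ T v b ∧ ∀ b' ∈ seNeighbors μ b, T b' ≠ v + 1) ∨
        T b = v + 1 ∧ ∃ e, IsHoleAt μ T v e ∧ b ∈ seNeighbors μ e := by
  constructor
  · rintro ⟨hole, hle, hlt⟩
    by_cases hTb : T b = v + 1
    · refine .inr ⟨hTb, ?_⟩
      cases hole with
      | corner hb =>
        have := (hT.eq_one_iff hb).2 rfl
        omega
      | @slide e _ he hbe hmin =>
        have := hT.lt e b hbe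
        refine ⟨e, ⟨he, by omega, fun b' hb' => ?_⟩, hbe⟩
        have := minLabel_le (T := T) hb'
        omega
    · exact .inl ⟨⟨hole, by omega, fun b' hb' => (hlt b' hb').le⟩, fun b' hb' => (hlt b' hb').ne'⟩
  · rintro (⟨⟨hole, hle, hlt⟩, hne⟩ | ⟨hTb, e, ⟨he, -, hlt⟩, hbe⟩)
    · exact ⟨hole, by omega, fun b' hb' => lt_of_le_of_ne (hlt b' hb') (hne b' hb').symm⟩
    · have hmin : T b = minLabel μ T e := by
        obtain ⟨b', hb', hmin⟩ := exists_eq_minLabel (T := T) ⟨b, hbe⟩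
        have := hlt b' hb'
        have := minLabel_le (T := T) hbe
        omega
      exact ⟨he.slide hbe hmin, hTb.le, fun b' hb' => hTb ▸ hT.lt b b' hb'⟩

theorem exists_isHoleAt (hT : IsIncreasing μ M T) (hμ : (0, 0) ∈ μ) (hv : 1 ≤ v) :
    ∃ b, IsHoleAt μ T v b := by
  induction v, hv using Nat.le_induction with
  | base => exact ⟨_, (isHoleAt_one hT).2 ⟨rfl, hμ⟩⟩
  | succ v hv ih =>
    obtain ⟨e, he⟩ := ih
    by_cases hnext : ∃ b ∈ seNeighbors μ e, T b = v + 1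
    · obtain ⟨b, hbe, hTb⟩ := hnext
      exact ⟨b, (isHoleAt_succ hT hv).2 (.inr ⟨hTb, e, he, hbe⟩)⟩
    · push Not at hnext
      exact ⟨e, (isHoleAt_succ hT hv).2 (.inl ⟨he, hnext⟩)⟩

end IsHoleAt

section Evacuation

variable {μ : YoungDiagram} {M j : ℕ} {T : Filling} {b : ℕ × ℕ}

theorem IsIncreasing.corner_mem (hT : IsIncreasing μ M T) (hM : 1 ≤ M) : (0, 0) ∈ μ := by
  obtain ⟨b, hb, -⟩ := hT.exists_eq 1 Nat.one_pos hM
  exact μ.up_left_mem (Nat.zero_le _) (Nat.zero_le _) hb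

theorem IsIncreasing.kPromotion_lt (hT : IsIncreasing μ M T) {e : ℕ × ℕ}
    (hbe : b ∈ seNeighbors μ e) : kPromotion μ T e < kPromotion μ T b := by
  have hb := mem_of_mem_seNeighbors hbe
  have hlt := hT.lt e b hbe
  have hmin := minLabel_le (T := T) hbe
  have hPe := kPromotion_add_one hT (source_mem_of_mem_seNeighbors hbe)
  have hne : (seNeighbors μ e).Nonempty := ⟨b, hbe⟩
  rw [if_pos hne] at hPe
  have hPb := kPromotion_add_one hT hb
  by_cases holeb : IsHole μ T b
  · have : T b < kPromotion μ T b + 1 := by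
      rw [hPb, if_pos holeb]
      split_ifs with hne
      · obtain ⟨b', hb', hmin'⟩ := exists_eq_minLabel (T := T) hne
        exact hmin' ▸ hT.lt b b' hb'
      · exact Nat.lt_succ_of_le (hT.le b hb)
    split_ifs at hPe <;> omega
  · have hslide : IsHole μ T e → T b ≠ minLabel μ T e := fun he h => holeb (he.slide hbe h)
    rw [if_neg holeb] at hPb
    split_ifs at hPe with he
    · have := hslide he
      omega
    · omega

theorem IsIncreasing.exists_kPromotion_eq (hT : IsIncreasing μ M T) {v : ℕ} (hv : 0 < v)
    (hvM : v ≤ M) : ∃ b ∈ μ, kPromotion μ T b = v := by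
  rcases hvM.eq_or_lt with rfl | hlt
  · obtain ⟨b, hole, -, hnbr⟩ := exists_isHoleAt hT (hT.corner_mem hv) hv
    have hP := kPromotion_add_one hT hole.mem
    rw [if_pos hole, if_neg] at hP
    · exact ⟨b, hole.mem, by omega⟩
    · rintro ⟨b', hb'⟩
      exact (hnbr b' hb').not_ge (hT.le b' (mem_of_mem_seNeighbors hb'))
  · obtain ⟨b, hb, hTb⟩ := hT.exists_eq (v + 1) v.succ_pos hlt
    by_cases hole : IsHole μ T b
    · cases hole with
      | corner hb =>
        have := (hT.eq_one_iff hb).2 rfl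
        omega
      | @slide e _ he hbe hmin =>
        have hP := kPromotion_add_one hT he.mem
        have hne : (seNeighbors μ e).Nonempty := ⟨b, hbe⟩
        rw [if_pos he, if_pos hne] at hP
        exact ⟨e, he.mem, by omega⟩
    · have hP := kPromotion_add_one hT hb
      rw [if_neg hole] at hP
      exact ⟨b, hb, by omega⟩

theorem IsIncreasing.kPromotion (hT : IsIncreasing μ M T) :
    IsIncreasing μ M (kPromotion μ T) where
  eq_zero b hb := by rw [IncTableau.kPromotion, fillAndShift, if_neg hb]
  lt _ _ := hT.kPromotion_lt
  pos b hb := by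
    have hpos := hT.pos b hb
    by_contra! h0
    obtain ⟨hle, hat⟩ := (kPromotion_le_iff hT hb (hpos.trans_le (hT.le b hb))).1 h0
    exact hat ((isHoleAt_one hT).2 ⟨(hT.eq_one_iff hb).1 (by omega), hb⟩)
  le b hb := by
    have hP := kPromotion_add_one hT hb
    have := hT.le b hb
    split_ifs at hP with hole hne
    · obtain ⟨b', hb', hmin⟩ := exists_eq_minLabel (T := T) hne
      have := hT.le b' (mem_of_mem_seNeighbors hb')
      omega
    · omega
    · omega
  exists_eq _ := hT.exists_kPromotion_eq

theorem IsIncreasing.kPromotion_iterate (hT : IsIncreasing μ M T) (i : ℕ) :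
    IsIncreasing μ M ((IncTableau.kPromotion μ)^[i] T) := by
  induction i with
  | zero => exact hT
  | succ i ih => exact Function.iterate_succ_apply' (IncTableau.kPromotion μ) i T ▸ ih.kPromotion

theorem kPromotion_iterate_le_iff (hT : IsIncreasing μ M T) (hb : b ∈ μ) (hj : j < M) :
    (kPromotion μ)^[M - j] T b ≤ j ↔
      (kPromotion μ)^[M - (j + 1)] T b ≤ j + 1 ∧
        ¬ IsHoleAt μ ((kPromotion μ)^[M - (j + 1)] T) (j + 1) b := by
  rw [show M - j = M - (j + 1) + 1 by omega, Function.iterate_succ_apply',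
    kPromotion_le_iff (hT.kPromotion_iterate _) hb hj]

theorem kPromotion_iterate_le_of_le (hT : IsIncreasing μ M T) (hb : b ∈ μ) {i : ℕ} (hij : i ≤ j)
    (hj : j ≤ M) (h : (kPromotion μ)^[M - i] T b ≤ i) : (kPromotion μ)^[M - j] T b ≤ j := by
  induction j, hij using Nat.le_induction with
  | base => exact h
  | succ j _ ih => exact ((kPromotion_iterate_le_iff hT hb hj).1 (ih (by omega))).1

theorem evacuationVia_eq_zero {P : Filling → Filling} (hb : b ∉ μ) : evacuationVia P μ T b = 0 := by
  simp [evacuationVia, sublevel, hb]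

theorem kEvacuation_le_iff (hT : IsIncreasing μ M T) (hb : b ∈ μ) (hj : j ≤ M) :
    kEvacuation μ T b ≤ j ↔ (kPromotion μ)^[M - j] T b ≤ j := by
  have hchain : kEvacuation μ T b = sInf {i | i ≤ M ∧ (kPromotion μ)^[M - i] T b ≤ i} := by
    simp only [kEvacuation, evacuationVia, hT.maxEntry_eq, sublevel, Finset.mem_filter,
      YoungDiagram.mem_cells, hb, true_and]
  rw [hchain]
  constructor
  · intro hle
    have hmem := Nat.sInf_mem (s := {i | i ≤ M ∧ (kPromotion μ)^[M - i] T b ≤ i})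
      ⟨M, le_rfl, by simpa using hT.le b hb⟩
    exact kPromotion_iterate_le_of_le hT hb hle hj hmem.2
  · exact fun h => Nat.sInf_le ⟨hj, h⟩

theorem IsIncreasing.kEvacuation (hT : IsIncreasing μ M T) :
    IsIncreasing μ M (kEvacuation μ T) := by
  have hpos : ∀ b ∈ μ, 0 < IncTableau.kEvacuation μ T b := by
    intro b hb
    by_contra! h0
    exact (((kEvacuation_le_iff hT hb (Nat.zero_le M)).1 h0).not_gt
      ((hT.kPromotion_iterate _).pos b hb))
  have hle : ∀ b ∈ μ, IncTableau.kEvacuation μ T b ≤ M := fun b hb =>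
    (kEvacuation_le_iff hT hb le_rfl).2 ((hT.kPromotion_iterate _).le b hb)
  refine ⟨fun b hb => evacuationVia_eq_zero hb, fun e b hbe => ?_, hpos, hle, fun v hv hvM => ?_⟩
  · have hb := mem_of_mem_seNeighbors hbe
    have he := source_mem_of_mem_seNeighbors hbe
    obtain ⟨j, hj⟩ := Nat.exists_eq_add_one_of_ne_zero (hpos b hb).ne'
    have hjM : j < M := by have := hle b hb; omega
    have hTb : (IncTableau.kPromotion μ)^[M - (j + 1)] T b ≤ j + 1 :=
      (kEvacuation_le_iff hT hb hjM).1 hj.le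
    have hlt := (hT.kPromotion_iterate (M - (j + 1))).lt e b hbe
    rw [hj, Nat.lt_succ_iff, kEvacuation_le_iff hT he hjM.le, kPromotion_iterate_le_iff hT he hjM]
    exact ⟨by omega, fun hat => (hat.2.2 b hbe).not_ge hTb⟩
  · obtain ⟨j, rfl⟩ := Nat.exists_eq_add_one_of_ne_zero hv.ne'
    obtain ⟨b, hat⟩ := exists_isHoleAt (hT.kPromotion_iterate (M - (j + 1)))
      (hT.corner_mem (hv.trans_le hvM)) hv
    refine ⟨b, hat.1.mem, le_antisymm ((kEvacuation_le_iff hT hat.1.mem hvM).2 hat.2.1) ?_⟩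
    rw [Nat.succ_le_iff, ← not_le, kEvacuation_le_iff hT hat.1.mem (Nat.le_of_succ_le hvM),
      kPromotion_iterate_le_iff hT hat.1.mem hvM]
    exact fun h => h.2 hat

end Evacuation

/-! ### Ordinary promotion -/

/-- The box `p` of `μ` is empty in `S`, and the labels of the boxes of `μ` are distinct. -/
structure IsOneHole (μ : YoungDiagram) (S : Filling) (p : ℕ × ℕ) : Prop where
  mem : p ∈ μ
  eq_zero : S p = 0
  injOn : Set.InjOn S μ.cells

section OrdinaryPromotion

variable {μ : YoungDiagram} {S T : Filling} {p q : ℕ × ℕ}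

theorem IsOneHole.eq_zero_iff (h : IsOneHole μ S p) {b : ℕ × ℕ} (hb : b ∈ μ) :
    S b = 0 ↔ b = p :=
  ⟨fun h0 => h.injOn hb h.mem (h0.trans h.eq_zero.symm), fun hbp => hbp ▸ h.eq_zero⟩

theorem IsOneHole.comp_swap (h : IsOneHole μ S p) (hq : q ∈ μ) :
    IsOneHole μ (S ∘ Equiv.swap q p) q where
  mem := hq
  eq_zero := by simp [h.eq_zero]
  injOn := by
    refine h.injOn.comp (Equiv.swap q p).injective.injOn fun b hb => ?_
    by_cases hbq : b = q
    · simpa [hbq] using h.mem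
    · by_cases hbp : b = p
      · simpa [hbp] using hq
      · simpa [Equiv.swap_apply_of_ne_of_ne hbq hbp] using hb

theorem IsOneHole.kStep_eq_comp_swap (h : IsOneHole μ S p) (hq : q ∈ seNeighbors μ p)
    (hmin : S q = minLabel μ S p) : kStep μ S = S ∘ Equiv.swap q p := by
  have hqμ := mem_of_mem_seNeighbors hq
  have hqp : q ≠ p := by
    rintro rfl
    have := antidiagonal_of_mem_seNeighbors hq
    omega
  funext b
  rw [kStep, Function.comp_apply]
  by_cases hbp : b = p
  · rw [if_pos ⟨hbp ▸ h.mem, hbp ▸ h.eq_zero⟩, hbp, Equiv.swap_apply_right, hmin]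
  · rw [if_neg fun hb => hbp ((h.eq_zero_iff hb.1).1 hb.2)]
    by_cases hbq : b = q
    · rw [if_pos ⟨p, h.mem, h.eq_zero, hbq ▸ hq, hbq ▸ hmin⟩, hbq, Equiv.swap_apply_left, h.eq_zero]
    · rw [Equiv.swap_apply_of_ne_of_ne hbq hbp, if_neg]
      rintro ⟨e, he, he0, hbe, hbmin⟩
      obtain rfl := (h.eq_zero_iff he).1 he0
      exact hbq (h.injOn (mem_of_mem_seNeighbors hbe) hqμ (hbmin.trans hmin.symm))

theorem IsOneHole.kStep_eq_self (h : IsOneHole μ S p) (hp : seNeighbors μ p = ∅) :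
    kStep μ S = S := by
  funext b
  rw [kStep]
  split_ifs with hempty hslide
  · obtain rfl := (h.eq_zero_iff hempty.1).1 hempty.2
    rw [minLabel_eq_zero hp, h.eq_zero]
  · obtain ⟨e, he, he0, hbe, -⟩ := hslide
    obtain rfl := (h.eq_zero_iff he).1 he0
    simp [hp] at hbe
  · rfl

theorem IsOneHole.slideStep_eq (h : IsOneHole μ S p) (hq : q ∈ seNeighbors μ p)
    (hmin : S q = minLabel μ S p) : slideStep μ (S, p) = (S ∘ Equiv.swap q p, q) := by
  have hle : ∀ b ∈ seNeighbors μ p, b ≠ q → S q < S b := fun b hb hbq =>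
    lt_of_le_of_ne (hmin ▸ minLabel_le hb) fun heq =>
      hbq (h.injOn (mem_of_mem_seNeighbors hb) (mem_of_mem_seNeighbors hq) heq.symm)
  rw [Equiv.comp_swap_eq_update, h.eq_zero, slideStep]
  rcases mem_seNeighbors.1 hq with ⟨rfl | rfl, hqμ⟩
  · refine if_pos ⟨hqμ, or_iff_not_imp_left.2 fun hD => hle _ (mem_seNeighbors.2 ⟨.inr rfl, ?_⟩) ?_⟩
    · exact not_not.1 hD
    · simp
  · rw [if_neg, if_pos hqμ]
    rintro ⟨hR, hD | hlt⟩
    · exact hD hqμ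
    · exact hlt.not_gt (hle _ (mem_seNeighbors.2 ⟨.inl rfl, hR⟩) (by simp))

theorem slideStep_eq_self (hp : seNeighbors μ p = ∅) : slideStep μ (S, p) = (S, p) := by
  have hnone : ∀ b, b = (p.1, p.2 + 1) ∨ b = (p.1 + 1, p.2) → b ∉ μ := fun b hb hbμ => by
    have := mem_seNeighbors.2 ⟨hb, hbμ⟩
    simp [hp] at this
  rw [slideStep, if_neg fun h => hnone _ (.inl rfl) h.1, if_neg (hnone _ (.inr rfl))]

theorem IsOneHole.exists_slideStep_eq (h : IsOneHole μ S p) :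
    ∃ q, slideStep μ (S, p) = (kStep μ S, q) ∧ IsOneHole μ (kStep μ S) q := by
  rcases (seNeighbors μ p).eq_empty_or_nonempty with hp | hp
  · rw [slideStep_eq_self hp, h.kStep_eq_self hp]
    exact ⟨p, rfl, h⟩
  · obtain ⟨q, hq, hmin⟩ := exists_eq_minLabel (T := S) hp
    rw [h.slideStep_eq hq hmin, h.kStep_eq_comp_swap hq hmin]
    exact ⟨q, rfl, h.comp_swap (mem_of_mem_seNeighbors hq)⟩

theorem IsOneHole.exists_slideStep_iterate_eq (h : IsOneHole μ S p) (t : ℕ) :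
    ∃ q, (slideStep μ)^[t] (S, p) = ((kStep μ)^[t] S, q) ∧ IsOneHole μ ((kStep μ)^[t] S) q := by
  induction t with
  | zero => exact ⟨p, rfl, h⟩
  | succ t ih =>
    obtain ⟨q, hslide, hq⟩ := ih
    rw [Function.iterate_succ_apply', Function.iterate_succ_apply', hslide]
    exact hq.exists_slideStep_eq

theorem IsIncreasing.isOneHole_deleteOne (hT : IsIncreasing μ μ.card T) (hμ : (0, 0) ∈ μ) :
    IsOneHole μ (deleteOne T) (0, 0) where
  mem := hμ
  eq_zero := if_pos ((hT.eq_one_iff hμ).2 rfl)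
  injOn b hb b' hb' heq := by
    have := hT.pos b hb
    have := hT.pos b' hb'
    refine hT.injOn hb hb' ?_
    unfold deleteOne at heq
    split_ifs at heq <;> omega

theorem IsIncreasing.promotion_eq_kPromotion (hT : IsIncreasing μ μ.card T) :
    promotion μ T = IncTableau.kPromotion μ T := by
  rw [promotion, IncTableau.kPromotion]
  rcases Nat.eq_zero_or_pos μ.card with h0 | hpos
  · rw [h0, Function.iterate_zero, Function.iterate_zero, id, id]
  · obtain ⟨q, hslide, -⟩ :=
      (hT.isOneHole_deleteOne (hT.corner_mem hpos)).exists_slideStep_iterate_eq μ.card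
    rw [hslide]

theorem IsIncreasing.evacuation_eq_kEvacuation (hT : IsIncreasing μ μ.card T) :
    evacuation μ T = IncTableau.kEvacuation μ T := by
  have hiterate : ∀ i, (promotion μ)^[i] T = (IncTableau.kPromotion μ)^[i] T := by
    intro i
    induction i with
    | zero => rfl
    | succ i ih =>
      rw [Function.iterate_succ_apply', Function.iterate_succ_apply', ih,
        (hT.kPromotion_iterate i).promotion_eq_kPromotion]
  funext b
  simp only [evacuation, IncTableau.kEvacuation, evacuationVia, hiterate]

end OrdinaryPromotion

/-! ### Tableaux of flag shape as lattice paths -/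

theorem rect_two_eq_flagShape (n : ℕ) : rect 2 n = flagShape n 0 := by
  ext ⟨r, c⟩
  simp only [rect, flagShape, Finset.mem_product, Finset.mem_filter, Finset.mem_range]
  omega

/-- The boxes of a flag shape in coordinates: arm `0` is the first row, arm `1` the second row, and
arm `2` is the part of the first column below these, each of them numbered from `0`. -/
def box (s : Fin 3) (c : ℕ) : ℕ × ℕ := ![(0, c), (1, c), (c + 2, 0)] s

/-- The number of boxes of each arm of `flagShape n k`. -/
def armLen (n k : ℕ) : Fin 3 → ℕ := ![n - k, n - k, k]

/-- The box of `flagShape n k` with coordinates `s', c'`, if any, is immediately right of or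
immediately below the one with coordinates `s, c`. -/
def IsNext (s : Fin 3) (c : ℕ) (s' : Fin 3) (c' : ℕ) : Prop :=
  s' = s ∧ c' = c + 1 ∨ s = 0 ∧ s' = 1 ∧ c' = c ∨ s = 1 ∧ s' = 2 ∧ c = 0 ∧ c' = 0

section FlagShape

variable {n k : ℕ} {s s' : Fin 3} {c c' : ℕ} {b : ℕ × ℕ}

theorem mem_flagShape :
    b ∈ flagShape n k ↔ (b.1 < k + 2 ∧ b.2 < n - k) ∧ (b.1 < 2 ∨ b.2 = 0) := by
  rw [← YoungDiagram.mem_cells]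
  simp only [flagShape, Finset.mem_filter, Finset.mem_product, Finset.mem_range]

theorem box_mem_flagShape (hk : k < n) : box s c ∈ flagShape n k ↔ c < armLen n k s := by
  rw [mem_flagShape]
  fin_cases s <;> simp [box, armLen]; omega

theorem box_injective (h : box s c = box s' c') : s = s' ∧ c = c' := by
  fin_cases s <;> fin_cases s' <;> simp_all [box]

theorem exists_box_of_mem_flagShape (hb : b ∈ flagShape n k) : ∃ s c, b = box s c := by
  obtain ⟨r, c⟩ := b
  rcases mem_flagShape.1 hb with ⟨-, hr | hc⟩
  · interval_cases r
    · exact ⟨0, c, rfl⟩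
    · exact ⟨1, c, rfl⟩
  · rcases r with _ | _ | r
    · exact ⟨0, c, rfl⟩
    · exact ⟨1, c, rfl⟩
    · exact ⟨2, r, Prod.ext rfl hc⟩

theorem box_mem_seNeighbors (hk : k < n) :
    box s' c' ∈ seNeighbors (flagShape n k) (box s c) ↔ IsNext s c s' c' ∧ c' < armLen n k s' := by
  rw [mem_seNeighbors, box_mem_flagShape hk]
  refine and_congr_left fun hc' => ?_
  fin_cases s <;> fin_cases s' <;> simp [box, IsNext, armLen] at hc' ⊢; omega

theorem card_flagShape (hk : k < n) : (flagShape n k).card = ∑ s, armLen n k s := by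
  have hcells : (flagShape n k).cells =
      Finset.univ.biUnion fun s => (Finset.range (armLen n k s)).image (box s) := by
    ext b
    simp only [YoungDiagram.mem_cells, Finset.mem_biUnion, Finset.mem_univ, true_and,
      Finset.mem_image, Finset.mem_range]
    constructor
    · intro hb
      obtain ⟨s, c, rfl⟩ := exists_box_of_mem_flagShape hb
      exact ⟨s, c, (box_mem_flagShape hk).1 hb, rfl⟩
    · rintro ⟨s, c, hc, rfl⟩
      exact (box_mem_flagShape hk).2 hc
  rw [YoungDiagram.card, hcells, Finset.card_biUnion]
  · refine Finset.sum_congr rfl fun s _ => ?_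
    rw [Finset.card_image_of_injective _ fun c c' h => (box_injective h).2, Finset.card_range]
  · intro s _ s' _ hs
    refine Finset.disjoint_left.2 fun b hb hb' => ?_
    obtain ⟨c, -, rfl⟩ := Finset.mem_image.1 hb
    obtain ⟨c', -, h⟩ := Finset.mem_image.1 hb'
    exact hs (box_injective h).1.symm

end FlagShape

/-- The number of labels at most `v` in each arm of a tableau of shape `flagShape n k`. -/
def armCount (n k : ℕ) (T : Filling) (v : ℕ) (s : Fin 3) : ℕ :=
  ((Finset.range (armLen n k s)).filter fun c => T (box s c) ≤ v).card

/-- The properties of the family of arm counts of an increasing tableau of shape `flagShape n k`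
with labels `1, …, M`: it is a chain of lattice points inside the shape, whose steps are nonzero and
add a set of boxes no two of which are adjacent. -/
structure IsLattice (n k M : ℕ) (N : ℕ → Fin 3 → ℕ) : Prop where
  zero : N 0 = 0
  top : N M = armLen n k
  mono : ∀ v < M, ∀ s, N v s ≤ N (v + 1) s
  step : ∀ v < M, ∀ s, N (v + 1) s ≤ N v s + 1
  cover : ∀ v < M, ∃ s, N v s < N (v + 1) s
  below : ∀ v < M, N (v + 1) 1 ≤ N v 0
  column : ∀ v < M, 0 < N (v + 1) 2 → 0 < N v 1

section ArmCount

variable {n k M v : ℕ} {T : Filling} {N : ℕ → Fin 3 → ℕ} {s : Fin 3} {c : ℕ}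

theorem lt_card_filter_le_iff {f : ℕ → ℕ} {m : ℕ} (hf : ∀ c, c + 1 < m → f c ≤ f (c + 1))
    (hc : c < m) : c < ((Finset.range m).filter fun c => f c ≤ v).card ↔ f c ≤ v := by
  have hmono : ∀ c c', c ≤ c' → c' < m → f c ≤ f c' := fun c c' hcc' => by
    induction c', hcc' using Nat.le_induction with
    | base => exact fun _ => le_rfl
    | succ c' _ ih => exact fun h => (ih (by omega)).trans (hf c' h)
  constructor
  · intro hlt
    by_contra! hv
    have hsub : (Finset.range m).filter (fun c => f c ≤ v) ⊆ Finset.range c := fun c' hc' => by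
      rw [Finset.mem_filter, Finset.mem_range] at hc'
      by_contra hcc'
      have := hmono c c' (by simpa using hcc') hc'.1
      omega
    exact absurd (Finset.card_le_card hsub) (by simpa using hlt)
  · intro hv
    have hsub : Finset.range (c + 1) ⊆ (Finset.range m).filter (fun c => f c ≤ v) :=
      fun c' hc' => by
        rw [Finset.mem_range] at hc'
        rw [Finset.mem_filter, Finset.mem_range]
        exact ⟨by omega, (hmono c' c (by omega) hc).trans hv⟩
    simpa using Finset.card_le_card hsub

theorem armCount_le_armLen : armCount n k T v s ≤ armLen n k s :=
  (Finset.card_filter_le _ _).trans_eq (Finset.card_range _)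

theorem IsIncreasing.box_lt (hk : k < n) (hT : IsIncreasing (flagShape n k) M T) {s' : Fin 3}
    {c' : ℕ} (hnext : IsNext s c s' c') (hc' : c' < armLen n k s') : T (box s c) < T (box s' c') :=
  hT.lt _ _ ((box_mem_seNeighbors hk).2 ⟨hnext, hc'⟩)

theorem IsIncreasing.lt_armCount_iff (hk : k < n) (hT : IsIncreasing (flagShape n k) M T) :
    c < armCount n k T v s ↔ T (box s c) ≤ v ∧ c < armLen n k s := by
  by_cases hc : c < armLen n k s
  · rw [and_iff_left hc]
    exact lt_card_filter_le_iff (fun c hc => (hT.box_lt hk (.inl ⟨rfl, rfl⟩) hc).le) hc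
  · exact iff_of_false (fun h => hc (h.trans_le armCount_le_armLen)) fun h => hc h.2

theorem IsIncreasing.box_eq_iff (hk : k < n) (hT : IsIncreasing (flagShape n k) M T) :
    T (box s c) = v + 1 ↔ armCount n k T v s ≤ c ∧ c < armCount n k T (v + 1) s := by
  rw [← not_lt, hT.lt_armCount_iff hk, hT.lt_armCount_iff hk]
  by_cases hc : c < armLen n k s
  · omega
  · have := hT.eq_zero _ (mt (box_mem_flagShape hk).1 hc)
    omega

theorem IsIncreasing.isLattice (hk : k < n) (hT : IsIncreasing (flagShape n k) M T) :
    IsLattice n k M (armCount n k T) where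
  zero := by
    funext s
    by_contra hne
    obtain ⟨hle, hc⟩ := (hT.lt_armCount_iff hk).1 (Nat.pos_of_ne_zero hne)
    exact hle.not_gt (hT.pos _ ((box_mem_flagShape hk).2 hc))
  top := by
    funext s
    refine le_antisymm armCount_le_armLen (not_lt.1 fun hlt => ?_)
    exact lt_irrefl _ ((hT.lt_armCount_iff hk).2
      ⟨hT.le _ ((box_mem_flagShape hk).2 hlt), hlt⟩)
  mono v _ s := by
    by_contra! hlt
    obtain ⟨hle, hc⟩ := (hT.lt_armCount_iff hk).1 hlt
    exact lt_irrefl _ ((hT.lt_armCount_iff hk).2 ⟨hle.trans v.le_succ, hc⟩)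
  step v _ s := by
    by_contra! hlt
    obtain ⟨hle, hc⟩ := (hT.lt_armCount_iff hk).1 hlt
    have hlt' := hT.box_lt hk (.inl ⟨rfl, rfl⟩) hc
    exact lt_irrefl (armCount n k T v s) ((hT.lt_armCount_iff hk).2 ⟨by omega, by omega⟩)
  cover v hv := by
    obtain ⟨b, hb, hTb⟩ := hT.exists_eq (v + 1) v.succ_pos hv
    obtain ⟨s, c, rfl⟩ := exists_box_of_mem_flagShape hb
    have := (hT.box_eq_iff hk).1 hTb
    exact ⟨s, by omega⟩
  below v _ := by
    by_contra! hlt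
    obtain ⟨hle, hc⟩ := (hT.lt_armCount_iff hk).1 hlt
    have hlt' := hT.box_lt hk (.inr (.inl ⟨rfl, rfl, rfl⟩)) hc
    exact lt_irrefl _ ((hT.lt_armCount_iff hk).2 ⟨by omega, hc⟩)
  column v _ h2 := by
    obtain ⟨hle, hc⟩ := (hT.lt_armCount_iff hk).1 h2
    have hlt' := hT.box_lt hk (.inr (.inr ⟨rfl, rfl, rfl, rfl⟩)) hc
    exact (hT.lt_armCount_iff hk).2 ⟨by omega, by simp [armLen]; omega⟩

theorem IsLattice.mono_le (hN : IsLattice n k M N) {v w : ℕ} (hvw : v ≤ w) (hw : w ≤ M) :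
    N v s ≤ N w s := by
  induction w, hvw using Nat.le_induction with
  | base => exact le_rfl
  | succ w _ ih => exact (ih (by omega)).trans (hN.mono w hw s)

theorem IsLattice.le_armLen (hN : IsLattice n k M N) (hv : v ≤ M) : N v s ≤ armLen n k s :=
  hN.top ▸ hN.mono_le hv le_rfl

theorem IsLattice.sum_eq (hN : IsLattice n k M N) (hM : M = ∑ s, armLen n k s) (hv : v ≤ M) :
    ∑ s, N v s = v := by
  have hstep : ∀ v < M, ∑ s, N v s < ∑ s, N (v + 1) s := fun v hv =>
    Finset.sum_lt_sum (fun s _ => hN.mono v hv s) ((hN.cover v hv).imp fun s h => ⟨by simp, h⟩)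
  have hge : ∀ v ≤ M, v ≤ ∑ s, N v s := fun v => by
    induction v with
    | zero => exact fun _ => Nat.zero_le _
    | succ v ih => exact fun hv => (Nat.succ_le_succ (ih (by omega))).trans (hstep v hv)
  refine le_antisymm (Nat.decreasingInduction' (P := fun v => ∑ s, N v s ≤ v)
    (fun w hw _ ih => ?_) hv ?_) (hge v hv)
  · have := hstep w hw
    omega
  · rw [hN.top, ← hM]

theorem IsLattice.isIncreasing (hk : k < n) (hN : IsLattice n k M N)
    (hzero : ∀ b ∉ flagShape n k, T b = 0)
    (hbox : ∀ s, ∀ c < armLen n k s, ∀ v ≤ M, (T (box s c) ≤ v ↔ c < N v s)) :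
    IsIncreasing (flagShape n k) M T := by
  have hpos : ∀ b ∈ flagShape n k, 0 < T b := fun b hb => by
    obtain ⟨s, c, rfl⟩ := exists_box_of_mem_flagShape hb
    by_contra! h0
    simpa [hN.zero] using (hbox s c ((box_mem_flagShape hk).1 hb) 0 M.zero_le).1 h0
  have hle : ∀ b ∈ flagShape n k, T b ≤ M := fun b hb => by
    obtain ⟨s, c, rfl⟩ := exists_box_of_mem_flagShape hb
    have hc := (box_mem_flagShape hk).1 hb
    exact (hbox s c hc M le_rfl).2 (hN.top ▸ hc)
  refine ⟨hzero, fun e b hbe => ?_, hpos, hle, fun v hv hvM => ?_⟩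
  · have hb := mem_of_mem_seNeighbors hbe
    have he := source_mem_of_mem_seNeighbors hbe
    obtain ⟨s', c', rfl⟩ := exists_box_of_mem_flagShape hb
    obtain ⟨s, c, rfl⟩ := exists_box_of_mem_flagShape he
    obtain ⟨hnext, hc'⟩ := (box_mem_seNeighbors hk).1 hbe
    obtain ⟨v, hv⟩ := Nat.exists_eq_add_one_of_ne_zero (hpos _ hb).ne'
    have hvM : v < M := by have := hle _ hb; omega
    have hlt := (hbox s' c' hc' (v + 1) hvM).1 hv.le
    rw [hv, Nat.lt_add_one_iff, hbox s c ((box_mem_flagShape hk).1 he) v hvM.le]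
    rcases hnext with ⟨rfl, rfl⟩ | ⟨rfl, rfl, rfl⟩ | ⟨rfl, rfl, rfl, rfl⟩
    · have := hN.step v hvM s'
      omega
    · exact hlt.trans_le (hN.below v hvM)
    · exact hN.column v hvM hlt
  · obtain ⟨v, rfl⟩ := Nat.exists_eq_add_one_of_ne_zero hv.ne'
    obtain ⟨s, hs⟩ := hN.cover v hvM
    have hc : N v s < armLen n k s := hs.trans_le (hN.le_armLen hvM)
    refine ⟨_, (box_mem_flagShape hk).2 hc,
      le_antisymm ((hbox s _ hc (v + 1) hvM).2 hs) (Nat.succ_le_iff.2 (not_le.1 ?_))⟩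
    rw [hbox s _ hc v (by omega)]
    exact lt_irrefl _

theorem armCount_eq_of_forall_iff (hle : N v s ≤ armLen n k s)
    (hbox : ∀ c < armLen n k s, (T (box s c) ≤ v ↔ c < N v s)) : armCount n k T v s = N v s := by
  have : (Finset.range (armLen n k s)).filter (fun c => T (box s c) ≤ v) =
      Finset.range (N v s) := by
    ext c
    rw [Finset.mem_filter, Finset.mem_range, Finset.mem_range]
    exact ⟨fun h => (hbox c h.1).1 h.2, fun h => ⟨by omega, (hbox c (by omega)).2 h⟩⟩
  rw [armCount, this, Finset.card_range]

theorem IsLattice.exists_isIncreasing (hk : k < n) (hN : IsLattice n k M N) :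
    ∃ T, IsIncreasing (flagShape n k) M T ∧ ∀ v ≤ M, armCount n k T v = N v := by
  let T : Filling := fun b => sInf {v | v ≤ M ∧ ∃ s c, box s c = b ∧ c < N v s}
  have hzero : ∀ b ∉ flagShape n k, T b = 0 := fun b hb => by
    refine Nat.sInf_eq_zero.2 (.inr (Set.eq_empty_of_forall_notMem ?_))
    rintro v ⟨hv, s, c, rfl, hc⟩
    exact hb ((box_mem_flagShape hk).2 (hc.trans_le (hN.le_armLen hv)))
  have hbox : ∀ s, ∀ c < armLen n k s, ∀ v ≤ M, (T (box s c) ≤ v ↔ c < N v s) := by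
    intro s c hc v hv
    constructor
    · intro hle
      obtain ⟨-, s', c', heq, hc'⟩ := Nat.sInf_mem (s := {v | v ≤ M ∧ ∃ s' c', box s' c' = box s c ∧
        c' < N v s'}) ⟨M, le_rfl, s, c, rfl, hN.top ▸ hc⟩
      obtain ⟨rfl, rfl⟩ := box_injective heq
      exact hc'.trans_le (hN.mono_le hle hv)
    · exact fun h => Nat.sInf_le ⟨hv, s, c, rfl, h⟩
  refine ⟨T, hN.isIncreasing hk hzero hbox, fun v hv => funext fun s => ?_⟩
  exact armCount_eq_of_forall_iff (hN.le_armLen hv) fun c hc => hbox s c hc v hv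

theorem IsIncreasing.ext_armCount (hk : k < n) (hT : IsIncreasing (flagShape n k) M T)
    {T' : Filling} (hT' : IsIncreasing (flagShape n k) M T')
    (h : ∀ v ≤ M, armCount n k T v = armCount n k T' v) : T = T' := by
  funext b
  by_cases hb : b ∈ flagShape n k
  · obtain ⟨s, c, rfl⟩ := exists_box_of_mem_flagShape hb
    have hiff : ∀ v ≤ M, (T (box s c) ≤ v ↔ T' (box s c) ≤ v) := fun v hv => by
      have hc := (box_mem_flagShape hk).1 hb
      have hcount := congrFun (h v hv) s
      rw [← and_iff_left (a := T _ ≤ v) hc, ← and_iff_left (a := T' _ ≤ v) hc,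
        ← hT.lt_armCount_iff hk, ← hT'.lt_armCount_iff hk, hcount]
    exact le_antisymm ((hiff _ (hT'.le _ hb)).2 le_rfl) ((hiff _ (hT.le _ hb)).1 le_rfl)
  · rw [hT.eq_zero b hb, hT'.eq_zero b hb]

end ArmCount

/-! ### Growth diagrams -/

/-- The local rule of the K-theoretic growth diagrams of flag shape. If `x`, `x'` are the arm counts
of `T` for the labels `v + 1`, `v + 2`, then `y`, `y'` are those of its K-promotion for the labels
`v`, `v + 1`. The hole has passed through arm `s` after the first `v + 1` labels
iff `y s < x s`, and is then in the box `x s - 1`. -/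
structure LocalRule (x x' y y' : Fin 3 → ℕ) : Prop where
  near : ∀ s, y' s ≤ x' s ∧ x' s ≤ y' s + 1
  first_row : y' 0 < x' 0 ↔ y 0 < x 0 ∧ (x 0 < x' 0 ∨ ¬ (x 1 + 1 = x 0 ∧ x 1 < x' 1))
  second_row : y' 1 < x' 1 ↔
    y 1 < x 1 ∧ (x 1 < x' 1 ∨ ¬ (x 1 = 1 ∧ x 2 = 0 ∧ 0 < x' 2)) ∨
      y 0 < x 0 ∧ x 1 + 1 = x 0 ∧ x 1 < x' 1
  column : y' 2 < x' 2 ↔ y 2 < x 2 ∨ y 1 < x 1 ∧ x 1 = 1 ∧ x 2 = 0 ∧ 0 < x' 2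

theorem LocalRule.unique {x x' y y' z : Fin 3 → ℕ} (hy : LocalRule x x' y y')
    (hz : LocalRule x x' y z) : y' = z := by
  funext s
  have hiff : y' s < x' s ↔ z s < x' s := by
    match s with
    | 0 => exact hy.first_row.trans hz.first_row.symm
    | 1 => exact hy.second_row.trans hz.second_row.symm
    | 2 => exact hy.column.trans hz.column.symm
  have := hy.near s
  have := hz.near s
  omega

theorem LocalRule.of_holes {x x' y y' : Fin 3 → ℕ} (mono : ∀ s, x s ≤ x' s)
    (step : ∀ s, x' s ≤ x s + 1) (near : ∀ s, y s ≤ x s ∧ x s ≤ y s + 1)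
    (near' : ∀ s, y' s ≤ x' s ∧ x' s ≤ y' s + 1)
    (hole : ∀ s c, y' s ≤ c ∧ c < x' s ↔
      ((y s ≤ c ∧ c < x s) ∧ ∀ s' c', IsNext s c s' c' → ¬ (x s' ≤ c' ∧ c' < x' s')) ∨
        (x s ≤ c ∧ c < x' s) ∧ ∃ s' c', (y s' ≤ c' ∧ c' < x s') ∧ IsNext s' c' s c) :
    LocalRule x x' y y' := by
  have hole₀ : ∀ c, y' 0 ≤ c ∧ c < x' 0 ↔
      (y 0 ≤ c ∧ c < x 0) ∧ ¬ (x 0 ≤ c + 1 ∧ c + 1 < x' 0) ∧ ¬ (x 1 ≤ c ∧ c < x' 1) ∨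
        (x 0 ≤ c ∧ c < x' 0) ∧ ∃ c', (y 0 ≤ c' ∧ c' < x 0) ∧ c = c' + 1 := fun c => by
    simpa [IsNext, Fin.forall_fin_succ, Fin.exists_fin_succ] using hole 0 c
  have hole₁ : ∀ c, y' 1 ≤ c ∧ c < x' 1 ↔
      (y 1 ≤ c ∧ c < x 1) ∧ ¬ (x 1 ≤ c + 1 ∧ c + 1 < x' 1) ∧ (c = 0 → x 2 = 0 → x' 2 = 0) ∨
        (x 1 ≤ c ∧ c < x' 1) ∧
          ((y 0 ≤ c ∧ c < x 0) ∨ ∃ c', (y 1 ≤ c' ∧ c' < x 1) ∧ c = c' + 1) := fun c => by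
    simpa [IsNext, Fin.forall_fin_succ, Fin.exists_fin_succ] using hole 1 c
  have hole₂ : ∀ c, y' 2 ≤ c ∧ c < x' 2 ↔
      (y 2 ≤ c ∧ c < x 2) ∧ ¬ (x 2 ≤ c + 1 ∧ c + 1 < x' 2) ∨
        (x 2 ≤ c ∧ c < x' 2) ∧
          ((y 1 = 0 ∧ 0 < x 1) ∧ c = 0 ∨ ∃ c', (y 2 ≤ c' ∧ c' < x 2) ∧ c = c' + 1) := fun c => by
    simpa [IsNext, Fin.forall_fin_succ, Fin.exists_fin_succ] using hole 2 c
  simp only [Fin.forall_fin_succ, Fin.isValue, Fin.succ_zero_eq_one, Fin.succ_one_eq_two,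
    IsEmpty.forall_iff, and_true] at mono step near
  refine ⟨near', ?_, ?_, ?_⟩
  · have := near' 0
    have := hole₀ (y' 0)
    have := hole₀ (y 0)
    have := hole₀ (x 0)
    clear hole hole₀ hole₁ hole₂
    grind
  · have := near' 1
    have := hole₁ (y' 1)
    have := hole₁ (y 1)
    have := hole₁ (x 1)
    clear hole hole₀ hole₁ hole₂
    grind
  · have := near' 2
    have := hole₂ (y' 2)
    have := hole₂ (y 2)
    have := hole₂ (x 2)
    clear hole hole₀ hole₁ hole₂
    grind

section Growth

variable {n k M v : ℕ} {T : Filling} {s : Fin 3} {c : ℕ}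

theorem isHoleAt_box_iff (hk : k < n) (hT : IsIncreasing (flagShape n k) M T) (hv : v < M) :
    IsHoleAt (flagShape n k) T (v + 1) (box s c) ↔
      armCount n k (kPromotion (flagShape n k) T) v s ≤ c ∧ c < armCount n k T (v + 1) s := by
  rw [← not_lt, hT.kPromotion.lt_armCount_iff hk, hT.lt_armCount_iff hk]
  by_cases hc : c < armLen n k s
  · rw [kPromotion_le_iff hT ((box_mem_flagShape hk).2 hc) hv]
    have hle : IsHoleAt (flagShape n k) T (v + 1) (box s c) → T (box s c) ≤ v + 1 := fun h => h.2.1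
    tauto
  · exact iff_of_false (fun h => hc ((box_mem_flagShape hk).1 h.1.mem)) fun h => hc h.2.2

theorem isHoleAt_box_succ (hk : k < n) (hT : IsIncreasing (flagShape n k) M T) (hv : 1 ≤ v) :
    IsHoleAt (flagShape n k) T (v + 1) (box s c) ↔
      (IsHoleAt (flagShape n k) T v (box s c) ∧
          ∀ s' c', IsNext s c s' c' → T (box s' c') ≠ v + 1) ∨
        T (box s c) = v + 1 ∧
          ∃ s' c', IsHoleAt (flagShape n k) T v (box s' c') ∧ IsNext s' c' s c := by
  rw [isHoleAt_succ hT hv]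
  refine or_congr (and_congr_right fun _ => ?_) (and_congr_right fun hTb => ?_)
  · constructor
    · intro h s' c' hnext hTb
      have hmem : box s' c' ∈ flagShape n k := by
        by_contra hb
        rw [hT.eq_zero _ hb] at hTb
        omega
      exact h _ ((box_mem_seNeighbors hk).2 ⟨hnext, (box_mem_flagShape hk).1 hmem⟩) hTb
    · intro h b' hb'
      obtain ⟨s', c', rfl⟩ := exists_box_of_mem_flagShape (mem_of_mem_seNeighbors hb')
      exact h _ _ ((box_mem_seNeighbors hk).1 hb').1
  · have hc : c < armLen n k s := by
      refine (box_mem_flagShape hk).1 (by_contra fun hb => ?_)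
      rw [hT.eq_zero _ hb] at hTb
      omega
    constructor
    · rintro ⟨e, he, hbe⟩
      obtain ⟨s', c', rfl⟩ := exists_box_of_mem_flagShape he.1.mem
      exact ⟨s', c', he, ((box_mem_seNeighbors hk).1 hbe).1⟩
    · rintro ⟨s', c', he, hnext⟩
      exact ⟨_, he, (box_mem_seNeighbors hk).2 ⟨hnext, hc⟩⟩

theorem armCount_kPromotion_near (hk : k < n) (hT : IsIncreasing (flagShape n k) M T)
    (hv : v < M) (s : Fin 3) :
    armCount n k (kPromotion (flagShape n k) T) v s ≤ armCount n k T (v + 1) s ∧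
      armCount n k T (v + 1) s ≤ armCount n k (kPromotion (flagShape n k) T) v s + 1 := by
  constructor
  · by_contra! hlt
    obtain ⟨hle, hc⟩ := (hT.kPromotion.lt_armCount_iff hk).1 hlt
    rw [kPromotion_le_iff hT ((box_mem_flagShape hk).2 hc) hv] at hle
    exact lt_irrefl _ ((hT.lt_armCount_iff hk).2 ⟨hle.1, hc⟩)
  · by_contra! hlt
    obtain ⟨-, -, hnbr⟩ := (isHoleAt_box_iff hk hT hv).2 ⟨le_rfl, (Nat.lt_succ_self _).trans hlt⟩
    obtain ⟨hle, hc⟩ := (hT.lt_armCount_iff hk).1 hlt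
    exact (hnbr _ ((box_mem_seNeighbors hk).2 ⟨.inl ⟨rfl, rfl⟩, hc⟩)).not_ge hle

theorem localRule_kPromotion (hk : k < n) (hT : IsIncreasing (flagShape n k) M T)
    (hv : v + 1 < M) :
    LocalRule (armCount n k T (v + 1)) (armCount n k T (v + 2))
      (armCount n k (kPromotion (flagShape n k) T) v)
      (armCount n k (kPromotion (flagShape n k) T) (v + 1)) := by
  refine .of_holes ((hT.isLattice hk).mono _ hv) ((hT.isLattice hk).step _ hv)
    (armCount_kPromotion_near hk hT (Nat.lt_of_succ_lt hv)) (armCount_kPromotion_near hk hT hv)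
    fun s c => ?_
  simp only [← isHoleAt_box_iff hk hT hv, ← isHoleAt_box_iff hk hT (Nat.lt_of_succ_lt hv),
    ← hT.box_eq_iff hk]
  exact isHoleAt_box_succ hk hT v.succ_pos

theorem armCount_kPromotion_iterate (hk : k < n) (hT : IsIncreasing (flagShape n k) M T)
    {a : ℕ → ℕ → Fin 3 → ℕ} (hzero : ∀ j ≤ M, a 0 j = armCount n k T j) (hdiag : ∀ i ≤ M, a i i = 0)
    (hlocal : ∀ i j, i < j → j < M →
      LocalRule (a i j) (a i (j + 1)) (a (i + 1) j) (a (i + 1) (j + 1)))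
    {i j : ℕ} (hij : i ≤ j) (hj : j ≤ M) :
    armCount n k ((kPromotion (flagShape n k))^[i] T) (j - i) = a i j := by
  induction i generalizing j with
  | zero => exact (hzero j hj).symm
  | succ i ih =>
    have hTi := hT.kPromotion_iterate i
    induction j, hij using Nat.le_induction with
    | base =>
      rw [Nat.sub_self, hdiag _ hj]
      exact ((hT.kPromotion_iterate _).isLattice hk).zero
    | succ j hij ihj =>
      have hrule := localRule_kPromotion hk hTi (v := j - (i + 1)) (by omega)
      rw [← Function.iterate_succ_apply' (kPromotion _), ihj (by omega),
        show j - (i + 1) + 1 = j - i by omega, show j - (i + 1) + 2 = j + 1 - i by omega,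
        ih (by omega) (by omega), ih (by omega) hj] at hrule
      rw [show j + 1 - (i + 1) = j - i by omega]
      exact hrule.unique (hlocal i j hij hj)

theorem armCount_kEvacuation (hk : k < n) (hT : IsIncreasing (flagShape n k) M T) (hv : v ≤ M) :
    armCount n k (kEvacuation (flagShape n k) T) v =
      armCount n k ((kPromotion (flagShape n k))^[M - v] T) v := by
  funext s
  refine congrArg Finset.card (Finset.filter_congr fun c hc => ?_)
  exact kEvacuation_le_iff hT ((box_mem_flagShape hk).2 (Finset.mem_range.1 hc)) hv

end Growth

/-! ### The growth diagram of a two-row rectangle -/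

/-- The difference of the two row lengths of the shape of the labels at most `v`. -/
def height (R : ℕ → Fin 3 → ℕ) (v : ℕ) : ℕ := R v 0 - R v 1

/-- The minimum of `height R` over `[i, j]`. -/
def low (R : ℕ → Fin 3 → ℕ) (i : ℕ) : ℕ → ℕ
  | 0 => height R 0
  | j + 1 => if j < i then height R (j + 1) else min (low R i j) (height R (j + 1))

/-- The minimum of the height over `[i, j]` when each label that occurs in both rows is read as two
steps, first the one in the second row, so that the height is `R v 0 - R (v + 1) 1` in between. -/
def dip (R : ℕ → Fin 3 → ℕ) (i : ℕ) : ℕ → ℕ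
  | 0 => height R 0
  | j + 1 => if j < i then height R (j + 1) else min (dip R i j) (R j 0 - R (j + 1) 1)

section RectGrowth

variable {n M i j v : ℕ} {R : ℕ → Fin 3 → ℕ}

theorem low_self : low R i i = height R i := by cases i <;> simp [low]

theorem dip_self : dip R i i = height R i := by cases i <;> simp [dip]

theorem low_succ (hij : i ≤ j) : low R i (j + 1) = min (low R i j) (height R (j + 1)) :=
  if_neg (not_lt.2 hij)

theorem dip_succ (hij : i ≤ j) : dip R i (j + 1) = min (dip R i j) (R j 0 - R (j + 1) 1) :=
  if_neg (not_lt.2 hij)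

theorem low_le_height (hij : i ≤ j) : low R i j ≤ height R j := by
  rcases hij.eq_or_lt with rfl | hlt
  · exact low_self.le
  · obtain ⟨j, rfl⟩ := Nat.exists_eq_add_one_of_ne_zero (by omega : j ≠ 0)
    exact (low_succ (by omega)).trans_le (min_le_right _ _)

theorem low_succ_left (hij : i < j) : low R i j = min (height R i) (low R (i + 1) j) := by
  induction j, hij using Nat.le_induction with
  | base => rw [low_succ le_rfl, low_self, low_self]
  | succ j hij ih => rw [low_succ (by omega), ih, low_succ hij, min_assoc]

theorem IsLattice.one_le_zero (hR : IsLattice n 0 M R) (hv : v ≤ M) : R v 1 ≤ R v 0 := by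
  rcases hv.eq_or_lt with rfl | hv
  · simp [hR.top, armLen]
  · exact (hR.mono v hv 1).trans (hR.below v hv)

theorem dip_succ_left (hR : IsLattice n 0 M R) (hij : i < j) (hj : j ≤ M) :
    dip R i j = min (R i 0 - R (i + 1) 1) (dip R (i + 1) j) := by
  have hmono := hR.mono i (by omega)
  have h0 := hmono 0
  have h1 := hmono 1
  induction j, hij using Nat.le_induction with
  | base =>
    rw [dip_succ le_rfl, dip_self, dip_self, height, height]
    omega
  | succ j hij ih => rw [dip_succ (by omega), ih (by omega), dip_succ hij, min_assoc]

theorem dip_le_low (hR : IsLattice n 0 M R) (hij : i ≤ j) (hj : j ≤ M) :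
    dip R i j ≤ low R i j ∧ low R i j ≤ dip R i j + 1 := by
  induction j, hij using Nat.le_induction with
  | base =>
    rw [dip_self, low_self]
    omega
  | succ j hij ih =>
    have := ih (by omega)
    have := hR.mono j hj 0
    have := hR.mono j hj 1
    have := hR.step j hj 0
    have := hR.step j hj 1
    have := hR.below j hj
    have := low_le_height (R := R) hij
    rw [low_succ hij, dip_succ hij]
    unfold height at *
    omega

/-- The growth diagram whose row `i` lists the arm counts of the `i`-fold K-promotion of the
two-row tableau with arm counts `R`, in closed form; the column index runs over `[i, M]`. -/
def rectGrowth (R : ℕ → Fin 3 → ℕ) (i j : ℕ) : Fin 3 → ℕ :=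
  ![R j 0 - R i 1 - low R i j, R j 1 + dip R i j - R i 0, 0]

theorem low_le_height_left (hij : i ≤ j) : low R i j ≤ height R i := by
  rcases hij.eq_or_lt with rfl | hlt
  · exact low_self.le
  · exact (low_succ_left hlt).trans_le (min_le_left _ _)

theorem IsLattice.column_eq_zero (hR : IsLattice n 0 M R) (hv : v ≤ M) : R v 2 = 0 :=
  Nat.le_zero.1 (hR.le_armLen hv)

theorem IsLattice.row_step (hR : IsLattice n 0 M R) (hv : v < M) :
    (R v 0 ≤ R (v + 1) 0 ∧ R (v + 1) 0 ≤ R v 0 + 1) ∧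
      (R v 1 ≤ R (v + 1) 1 ∧ R (v + 1) 1 ≤ R v 1 + 1) ∧ R (v + 1) 1 ≤ R v 0 ∧
      (R v 0 < R (v + 1) 0 ∨ R v 1 < R (v + 1) 1) := by
  refine ⟨⟨hR.mono v hv 0, hR.step v hv 0⟩, ⟨hR.mono v hv 1, hR.step v hv 1⟩, hR.below v hv, ?_⟩
  obtain ⟨s, hs⟩ := hR.cover v hv
  match s with
  | 0 => exact .inl hs
  | 1 => exact .inr hs
  | 2 => exact absurd hs (by simp [hR.column_eq_zero (v := v + 1) hv])

theorem IsLattice.le_one_add_dip (hR : IsLattice n 0 M R) (hij : i ≤ j) (hj : j ≤ M) :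
    R i 0 ≤ R j 1 + dip R i j := by
  induction j, hij using Nat.le_induction with
  | base =>
    have := hR.one_le_zero hj
    rw [dip_self, height]
    omega
  | succ j hij ih =>
    have := ih (by omega)
    have := hR.mono j hj 1
    have := hR.below j hj
    have := hR.mono_le (s := 0) hij (by omega)
    rw [dip_succ hij]
    omega

theorem IsLattice.rectGrowth_hole_zero (hR : IsLattice n 0 M R) (hij : i < j) (hj : j ≤ M) :
    (rectGrowth R (i + 1) j 0 ≤ rectGrowth R i j 0 ∧
      rectGrowth R i j 0 ≤ rectGrowth R (i + 1) j 0 + 1) ∧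
    (rectGrowth R (i + 1) j 0 < rectGrowth R i j 0 ↔
      R i 1 < R (i + 1) 1 ∨ height R i < low R (i + 1) j) := by
  have hi := hR.row_step (hij.trans_le hj)
  have hle := hR.one_le_zero hj
  have hmono : R (i + 1) 1 ≤ R j 1 := hR.mono_le hij hj
  have hi' := low_le_height_left (R := R) (show i + 1 ≤ j from hij)
  have hj' := low_le_height (R := R) (show i + 1 ≤ j from hij)
  simp only [rectGrowth, Matrix.cons_val, low_succ_left hij]
  unfold height at *
  omega

theorem IsLattice.rectGrowth_hole_one (hR : IsLattice n 0 M R) (hij : i < j) (hj : j ≤ M) :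
    (rectGrowth R (i + 1) j 1 ≤ rectGrowth R i j 1 ∧
      rectGrowth R i j 1 ≤ rectGrowth R (i + 1) j 1 + 1) ∧
    (rectGrowth R (i + 1) j 1 < rectGrowth R i j 1 ↔
      R i 0 < R (i + 1) 0 ∧ dip R (i + 1) j < height R (i + 1)) := by
  have hi := hR.row_step (hij.trans_le hj)
  have hdip := hR.le_one_add_dip (show i + 1 ≤ j from hij) hj
  have hmono : R (i + 1) 1 ≤ R j 1 := hR.mono_le hij hj
  have hle := dip_le_low hR (show i + 1 ≤ j from hij) hj
  have hi' := low_le_height_left (R := R) (show i + 1 ≤ j from hij)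
  simp only [rectGrowth, Matrix.cons_val, dip_succ_left hR hij hj]
  unfold height at *
  omega

theorem IsLattice.rectGrowth_step_zero (hR : IsLattice n 0 M R) (hij : i ≤ j) (hj : j < M) :
    rectGrowth R i j 0 < rectGrowth R i (j + 1) 0 ↔
      R j 0 < R (j + 1) 0 ∨ height R (j + 1) < low R i j := by
  have hstep := hR.row_step hj
  have hmono : R i 1 ≤ R j 1 := hR.mono_le hij hj.le
  have hj' := low_le_height (R := R) hij
  simp only [rectGrowth, Matrix.cons_val, low_succ hij]
  unfold height at *
  omega

theorem IsLattice.rectGrowth_step_one (hR : IsLattice n 0 M R) (hij : i ≤ j) (hj : j < M) :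
    (rectGrowth R i j 1 ≤ rectGrowth R i (j + 1) 1 ∧
      rectGrowth R i (j + 1) 1 ≤ rectGrowth R i j 1 + 1) ∧
    (rectGrowth R i j 1 < rectGrowth R i (j + 1) 1 ↔
      R j 1 < R (j + 1) 1 ∧ dip R i j < height R j) := by
  have hstep := hR.row_step hj
  have hdip := hR.le_one_add_dip hij hj.le
  have hj' := (dip_le_low hR hij hj.le).1.trans (low_le_height hij)
  simp only [rectGrowth, Matrix.cons_val, dip_succ hij]
  unfold height at *
  omega

theorem IsLattice.localRule_rectGrowth (hR : IsLattice n 0 M R) (hij : i < j) (hj : j < M) :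
    LocalRule (rectGrowth R i j) (rectGrowth R i (j + 1)) (rectGrowth R (i + 1) j)
      (rectGrowth R (i + 1) (j + 1)) := by
  have hij' : i + 1 ≤ j := hij
  have hi := hR.row_step (hij.trans hj)
  have hj₁ := hR.row_step hj
  have hle := dip_le_low hR hij' hj.le
  have hlow := low_le_height (R := R) hij'
  have hlow' := low_le_height_left (R := R) hij'
  have hadj : rectGrowth R i j 1 + 1 = rectGrowth R i j 0 ↔
      dip R i j + low R i j + 1 = height R i + height R j := by
    have := hR.le_one_add_dip hij.le hj.le
    have := hR.one_le_zero hj.le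
    have := hR.one_le_zero (hij.trans hj).le
    have := low_le_height (R := R) hij.le
    have : R i 1 ≤ R j 1 := hR.mono_le hij.le hj.le
    simp only [rectGrowth, Matrix.cons_val]
    unfold height at *
    omega
  refine ⟨fun s => ?_, ?_, ?_, by simp [rectGrowth]⟩
  · match s with
    | 0 => exact (hR.rectGrowth_hole_zero (Nat.lt_succ_of_lt hij) hj).1
    | 1 => exact (hR.rectGrowth_hole_one (Nat.lt_succ_of_lt hij) hj).1
    | 2 => simp [rectGrowth]
  · rw [(hR.rectGrowth_hole_zero (Nat.lt_succ_of_lt hij) hj).2,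
      (hR.rectGrowth_hole_zero hij hj.le).2, hR.rectGrowth_step_zero hij.le hj,
      (hR.rectGrowth_step_one hij.le hj).2, hadj, low_succ hij', low_succ_left hij,
      dip_succ_left hR hij hj.le]
    unfold height at *
    omega
  · rw [(hR.rectGrowth_hole_one (Nat.lt_succ_of_lt hij) hj).2,
      (hR.rectGrowth_hole_zero hij hj.le).2, (hR.rectGrowth_hole_one hij hj.le).2,
      (hR.rectGrowth_step_one hij.le hj).2, hadj, dip_succ hij', low_succ_left hij,
      dip_succ_left hR hij hj.le]
    simp only [rectGrowth, Matrix.cons_val]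
    unfold height at *
    omega

theorem rectGrowth_self (hR : IsLattice n 0 M R) (hi : i ≤ M) : rectGrowth R i i = 0 := by
  have := hR.one_le_zero hi
  funext s
  match s with
  | 0 => simp [rectGrowth, low_self, height]
  | 1 => simp [rectGrowth, dip_self, height]; omega
  | 2 => rfl

theorem low_zero_left (hR : IsLattice n 0 M R) : low R 0 j = 0 := by
  have := low_le_height_left (R := R) j.zero_le
  simpa [height, hR.zero] using this

theorem low_right (hR : IsLattice n 0 M R) (hi : i ≤ M) : low R i M = 0 := by
  have := low_le_height (R := R) hi
  simpa [height, hR.top, armLen] using this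

theorem rectGrowth_zero_left (hR : IsLattice n 0 M R) (hj : j ≤ M) : rectGrowth R 0 j = R j := by
  have hdip : dip R 0 j = 0 :=
    Nat.le_zero.1 ((dip_le_low hR j.zero_le hj).1.trans_eq (low_zero_left hR))
  funext s
  match s with
  | 0 | 1 => simp [rectGrowth, low_zero_left hR, hdip, hR.zero]
  | 2 => simp [rectGrowth, hR.column_eq_zero hj]

/-- The arm counts of the two-row tableau with arm counts `R` after rotation by 180° and reversal
of the order of the labels. -/
def rotate (n M : ℕ) (R : ℕ → Fin 3 → ℕ) (v : ℕ) : Fin 3 → ℕ :=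
  ![n - R (M - v) 1, n - R (M - v) 0, 0]

theorem rectGrowth_right (hR : IsLattice n 0 M R) :
    rectGrowth R (M - v) M = rotate n M R v := by
  have hdip : dip R (M - v) M = 0 :=
    Nat.le_zero.1 ((dip_le_low hR (M.sub_le v) le_rfl).1.trans_eq (low_right hR (M.sub_le v)))
  simp [rectGrowth, low_right hR, hdip, hR.top, armLen, rotate]

end RectGrowth

/-! ### The growth diagram of a flag shape -/

/-- `1` if the last label at most `v` in the second row occurs in the first row as well, so that
its successor in the second row belongs to the set `B`, and `0` otherwise. -/
def carry (R : ℕ → Fin 3 → ℕ) : ℕ → ℕ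
  | 0 => 0
  | v + 1 => if R (v + 1) 1 = R v 1 then carry R v else R (v + 1) 0 - R v 0

/-- `1` if the first label greater than `i` in the first row occurs in the second row as well, and
`0` otherwise; this is `carry` for the rotated tableau. -/
def cocarry (n M : ℕ) (R : ℕ → Fin 3 → ℕ) (i : ℕ) : ℕ := carry (rotate n M R) (M - i)

/-- The number of labels in `(i, j]` that occur in both rows. -/
def repeats (R : ℕ → Fin 3 → ℕ) (i j : ℕ) : ℕ := R j 0 + R j 1 - R i 0 - R i 1 - (j - i)

/-- The growth diagram of the flag tableau associated with the two-row tableau with arm counts `R`,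
in closed form; compare `rectGrowth`. -/
def flagGrowth (n M : ℕ) (R : ℕ → Fin 3 → ℕ) (i j : ℕ) : Fin 3 → ℕ :=
  ![j - i - rectGrowth R i j 1,
    rectGrowth R i j 1 - (repeats R i j - carry R j - cocarry n M R i),
    repeats R i j - carry R j - cocarry n M R i]

/-- The arm counts of the flag tableau associated with the two-row tableau with arm counts `R`. Of
the labels at most `v`, `R v 0 + R v 1 - v` occur twice, and all of these except for `carry R v`
have their successor in the second row among the labels at most `v`. -/
def flagCount (R : ℕ → Fin 3 → ℕ) (v : ℕ) : Fin 3 → ℕ :=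
  ![v - R v 1, R v 1 - (R v 0 + R v 1 - v - carry R v), R v 0 + R v 1 - v - carry R v]

section FlagGrowth

variable {n M i j v : ℕ} {R : ℕ → Fin 3 → ℕ}

theorem carry_succ_of_eq (h : R (v + 1) 1 = R v 1) : carry R (v + 1) = carry R v := if_pos h

theorem carry_succ_of_lt (h : R v 1 < R (v + 1) 1) : carry R (v + 1) = R (v + 1) 0 - R v 0 :=
  if_neg h.ne'

theorem rotate_sub (hv : v ≤ M) : rotate n M R (M - v) = ![n - R v 1, n - R v 0, 0] := by
  rw [rotate, Nat.sub_sub_self hv]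

theorem cocarry_of_eq (hi : i < M) (h : R (i + 1) 0 = R i 0) :
    cocarry n M R i = cocarry n M R (i + 1) := by
  have hsucc : M - (i + 1) + 1 = M - i := by omega
  rw [cocarry, ← hsucc]
  refine carry_succ_of_eq ?_
  rw [hsucc, rotate_sub (v := i + 1) hi, rotate_sub hi.le]
  exact congrArg (n - ·) h.symm

theorem IsLattice.cocarry_of_lt (hR : IsLattice n 0 M R) (hi : i < M)
    (h : R i 0 < R (i + 1) 0) : cocarry n M R i = R (i + 1) 1 - R i 1 := by
  have hfirst : R (i + 1) 0 ≤ n := hR.le_armLen hi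
  have hsecond : R (i + 1) 1 ≤ n := hR.le_armLen hi
  have hstep := hR.row_step hi
  have hsucc : M - (i + 1) + 1 = M - i := by omega
  rw [cocarry, ← hsucc, carry_succ_of_lt] <;>
    rw [hsucc, rotate_sub (v := i + 1) hi, rotate_sub hi.le] <;>
    simp only [Matrix.cons_val] <;> omega

theorem IsLattice.growth_bounds (hR : IsLattice n 0 M R) (hij : i ≤ j) (hj : j ≤ M) :
    (R i 0 ≤ R j 0 ∧ R j 0 ≤ R i 0 + (j - i)) ∧ (R i 1 ≤ R j 1 ∧ R j 1 ≤ R i 1 + (j - i)) ∧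
      repeats R i j + (R i 0 + R i 1 + (j - i)) = R j 0 + R j 1 := by
  unfold repeats
  induction j, hij using Nat.le_induction with
  | base => omega
  | succ j hij ih =>
    have := ih (by omega)
    have := hR.row_step hj
    omega

theorem IsLattice.carry_step (hR : IsLattice n 0 M R) (hv : v < M) :
    (R (v + 1) 1 = R v 1 ∧ carry R (v + 1) = carry R v) ∨
      R (v + 1) 1 = R v 1 + 1 ∧ carry R (v + 1) + R v 0 = R (v + 1) 0 := by
  have := hR.row_step hv
  rw [carry]
  split_ifs <;> omega

theorem IsLattice.cocarry_step (hR : IsLattice n 0 M R) (hi : i < M) :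
    (R (i + 1) 0 = R i 0 ∧ cocarry n M R i = cocarry n M R (i + 1)) ∨
      R (i + 1) 0 = R i 0 + 1 ∧ cocarry n M R i + R i 1 = R (i + 1) 1 := by
  have := hR.row_step hi
  rcases this.1.1.eq_or_lt with h | h
  · exact .inl ⟨h.symm, cocarry_of_eq hi h.symm⟩
  · rw [hR.cocarry_of_lt hi h]
    omega

theorem IsLattice.carry_le_one (hR : IsLattice n 0 M R) (hv : v ≤ M) : carry R v ≤ 1 := by
  induction v with
  | zero => exact zero_le_one
  | succ v ih =>
    have := hR.row_step hv
    have := hR.carry_step hv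
    have := ih (by omega)
    omega

theorem IsLattice.cocarry_le_one (hR : IsLattice n 0 M R) (hi : i ≤ M) : cocarry n M R i ≤ 1 := by
  induction hi using Nat.decreasingInduction with
  | self => simp [cocarry, carry]
  | of_succ i hi ih =>
    have := hR.row_step hi
    have := hR.cocarry_step hi
    omega

theorem IsLattice.dip_add_carry_le (hR : IsLattice n 0 M R) (hij : i ≤ j) (hj : j ≤ M)
    (h : R i 1 < R j 1) : dip R i j + carry R j ≤ height R j := by
  induction j, hij using Nat.le_induction with
  | base => omega
  | succ j hij ih =>
    have := hR.row_step hj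
    have := hR.carry_step hj
    have := ih (by omega)
    rw [dip_succ hij]
    unfold height at *
    omega

theorem IsLattice.dip_add_cocarry_le (hR : IsLattice n 0 M R) (hij : i ≤ j) (hj : j ≤ M)
    (h : R i 0 < R j 0) : dip R i j + cocarry n M R i ≤ height R i := by
  induction hij using Nat.decreasingInduction with
  | self => omega
  | of_succ i hij ih =>
    have := hR.row_step (hij.trans_le hj)
    have := hR.cocarry_step (hij.trans_le hj)
    rw [dip_succ_left hR hij hj]
    unfold height at *
    omega

theorem IsLattice.cocarry_le_repeats (hR : IsLattice n 0 M R) (hij : i ≤ j) (hj : j ≤ M)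
    (h : R i 0 < R j 0) : cocarry n M R i ≤ repeats R i j := by
  induction hij using Nat.decreasingInduction with
  | self => omega
  | of_succ i hij ih =>
    have := hR.growth_bounds (show i + 1 ≤ j from hij) hj
    have := hR.growth_bounds hij.le hj
    have := hR.row_step (hij.trans_le hj)
    have := hR.cocarry_step (hij.trans_le hj)
    omega

theorem IsLattice.one_add_dip_le (hR : IsLattice n 0 M R) (hij : i ≤ j) (hj : j ≤ M)
    (h : repeats R i j < carry R j + cocarry n M R i) : R j 1 + dip R i j ≤ R i 0 := by
  induction j, hij using Nat.le_induction with
  | base =>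
    have := hR.one_le_zero hj
    rw [dip_self, height]
    omega
  | succ j hij ih =>
    have := hR.growth_bounds hij (Nat.le_of_lt hj)
    have := hR.growth_bounds (show i ≤ j + 1 by omega) hj
    have := hR.cocarry_le_repeats hij (Nat.le_of_lt hj)
    have := hR.carry_step hj
    have := hR.row_step hj
    have := ih (by omega)
    rw [dip_succ hij]
    omega

theorem IsLattice.zero_le_dip (hR : IsLattice n 0 M R) (hij : i ≤ j) (hj : j ≤ M) :
    R j 0 ≤ R i 1 + dip R i j + (j - i) + carry R j := by
  induction j, hij using Nat.le_induction with
  | base =>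
    rw [dip_self, height]
    omega
  | succ j hij ih =>
    have := ih (by omega)
    have := hR.growth_bounds hij (Nat.le_of_lt hj)
    have := (dip_le_low hR hij (Nat.le_of_lt hj)).1.trans (low_le_height hij)
    have := hR.carry_le_one (Nat.le_of_lt hj)
    have := hR.carry_step hj
    have := hR.row_step hj
    rw [dip_succ hij]
    unfold height at *
    omega

theorem IsLattice.flagGrowth_two_le (hR : IsLattice n 0 M R) (hij : i ≤ j) (hj : j ≤ M) :
    flagGrowth n M R i j 2 ≤ rectGrowth R i j 1 ∧ rectGrowth R i j 1 ≤ j - i := by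
  have hbounds := hR.growth_bounds hij hj
  have hle := hR.zero_le_dip hij hj
  have hdip := hR.le_one_add_dip hij hj
  have hlow := (dip_le_low hR hij hj).1.trans (low_le_height_left hij)
  have := hR.one_le_zero (hij.trans hj)
  simp only [flagGrowth, rectGrowth, Matrix.cons_val]
  unfold height at *
  omega

theorem IsLattice.flagGrowth_hole_zero (hR : IsLattice n 0 M R) (hij : i < j) (hj : j ≤ M) :
    (flagGrowth n M R (i + 1) j 0 ≤ flagGrowth n M R i j 0 ∧
      flagGrowth n M R i j 0 ≤ flagGrowth n M R (i + 1) j 0 + 1) ∧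
    (flagGrowth n M R (i + 1) j 0 < flagGrowth n M R i j 0 ↔
      ¬ (R i 0 < R (i + 1) 0 ∧ dip R (i + 1) j < height R (i + 1))) := by
  have hrect := hR.rectGrowth_hole_one hij hj
  have hle' := (hR.flagGrowth_two_le (show i + 1 ≤ j from hij) hj).2
  rw [← hrect.2]
  simp only [flagGrowth, Matrix.cons_val]
  omega

theorem IsLattice.flagGrowth_hole_two (hR : IsLattice n 0 M R) (hij : i < j) (hj : j ≤ M) :
    (flagGrowth n M R (i + 1) j 2 ≤ flagGrowth n M R i j 2 ∧
      flagGrowth n M R i j 2 ≤ flagGrowth n M R (i + 1) j 2 + 1) ∧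
    (flagGrowth n M R (i + 1) j 2 < flagGrowth n M R i j 2 ↔
      R i 0 < R (i + 1) 0 ∧ cocarry n M R (i + 1) = 1 ∧ carry R j < repeats R (i + 1) j) := by
  have hbounds := hR.growth_bounds hij.le hj
  have hbounds' := hR.growth_bounds (show i + 1 ≤ j from hij) hj
  have hone := hR.cocarry_le_one (i := i + 1) (hij.trans_le hj)
  have hi := hR.row_step (hij.trans_le hj)
  have hcocarry := hR.cocarry_step (hij.trans_le hj)
  simp only [flagGrowth, Matrix.cons_val]
  omega

theorem IsLattice.flagGrowth_hole_one (hR : IsLattice n 0 M R) (hij : i < j) (hj : j ≤ M) :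
    flagGrowth n M R (i + 1) j 1 ≤ flagGrowth n M R i j 1 ∧
      flagGrowth n M R i j 1 ≤ flagGrowth n M R (i + 1) j 1 + 1 := by
  have hrect := hR.rectGrowth_hole_one hij hj
  have htwo := hR.flagGrowth_hole_two hij hj
  have hle := (hR.flagGrowth_two_le hij.le hj).1
  have hle' := (hR.flagGrowth_two_le (show i + 1 ≤ j from hij) hj).1
  have hdip : cocarry n M R (i + 1) = 1 → carry R j < repeats R (i + 1) j →
      dip R (i + 1) j < height R (i + 1) := fun h1 hlt => by
    have hbounds := hR.growth_bounds (show i + 1 ≤ j from hij) hj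
    have := hR.dip_add_cocarry_le (show i + 1 ≤ j from hij) hj (by omega)
    omega
  have heq : ∀ i', flagGrowth n M R i' j 1 = rectGrowth R i' j 1 - flagGrowth n M R i' j 2 :=
    fun _ => rfl
  rw [heq, heq]
  omega

theorem IsLattice.flagGrowth_step_zero (hR : IsLattice n 0 M R) (hij : i ≤ j) (hj : j < M) :
    flagGrowth n M R i j 0 < flagGrowth n M R i (j + 1) 0 ↔
      ¬ (R j 1 < R (j + 1) 1 ∧ dip R i j < height R j) := by
  have hle := (hR.flagGrowth_two_le hij hj.le).2
  have hle' := (hR.flagGrowth_two_le (show i ≤ j + 1 by omega) hj).2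
  have hrect := hR.rectGrowth_step_one hij hj
  rw [← hrect.2]
  simp only [flagGrowth, Matrix.cons_val]
  omega

theorem IsLattice.flagGrowth_step_two (hR : IsLattice n 0 M R) (hij : i ≤ j) (hj : j < M) :
    (flagGrowth n M R i j 2 ≤ flagGrowth n M R i (j + 1) 2 ∧
      flagGrowth n M R i (j + 1) 2 ≤ flagGrowth n M R i j 2 + 1) ∧
    (flagGrowth n M R i j 2 < flagGrowth n M R i (j + 1) 2 ↔
      R j 1 < R (j + 1) 1 ∧ carry R j = 1 ∧ cocarry n M R i < repeats R i j) := by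
  have hbounds := hR.growth_bounds hij hj.le
  have hbounds' := hR.growth_bounds (show i ≤ j + 1 by omega) hj
  have hone := hR.carry_le_one hj.le
  have hj₁ := hR.row_step hj
  have hcarry := hR.carry_step hj
  simp only [flagGrowth, Matrix.cons_val]
  omega

theorem IsLattice.flagGrowth_step_one (hR : IsLattice n 0 M R) (hij : i ≤ j) (hj : j < M) :
    flagGrowth n M R i j 1 < flagGrowth n M R i (j + 1) 1 ↔
      (R j 1 < R (j + 1) 1 ∧ dip R i j < height R j) ∧
        ¬ (R j 1 < R (j + 1) 1 ∧ carry R j = 1 ∧ cocarry n M R i < repeats R i j) := by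
  have hrect := hR.rectGrowth_step_one hij hj
  have htwo := hR.flagGrowth_step_two hij hj
  have hle := (hR.flagGrowth_two_le hij hj.le).1
  have hle' := (hR.flagGrowth_two_le (show i ≤ j + 1 by omega) hj).1
  have himp : carry R j = 1 → cocarry n M R i < repeats R i j →
      dip R i j < height R j := fun h1 hlt => by
    have hbounds := hR.growth_bounds hij hj.le
    have := hR.dip_add_carry_le hij hj.le (by omega)
    omega
  have heq : ∀ j', flagGrowth n M R i j' 1 = rectGrowth R i j' 1 - flagGrowth n M R i j' 2 :=
    fun _ => rfl
  rw [heq, heq]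
  omega

theorem IsLattice.flagGrowth_one_add_one_eq (hR : IsLattice n 0 M R) (hij : i ≤ j) (hj : j ≤ M) :
    flagGrowth n M R i j 1 + 1 = flagGrowth n M R i j 0 ↔
      (repeats R i j < carry R j + cocarry n M R i ∧ j = i + 1) ∨
        carry R j + cocarry n M R i ≤ repeats R i j ∧
          2 * dip R i j + 1 + carry R j + cocarry n M R i = height R i + height R j := by
  have hbounds := hR.growth_bounds hij hj
  have htwo := hR.flagGrowth_two_le hij hj
  have hone := hR.one_add_dip_le hij hj
  have hdip := hR.le_one_add_dip hij hj
  have hi := hR.one_le_zero (hij.trans hj)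
  have hj' := hR.one_le_zero hj
  simp only [flagGrowth, rectGrowth, Matrix.cons_val] at htwo ⊢
  unfold height
  rcases lt_or_ge (repeats R i j) (carry R j + cocarry n M R i) with h | h <;> omega

theorem IsLattice.carry_eq_one_of_flat (hR : IsLattice n 0 M R) (hij : i < j) (hj : j ≤ M)
    (hi : R (i + 1) 0 = R i 0) (hlt : dip R i j < height R j)
    (hadj : flagGrowth n M R i j 1 + 1 = flagGrowth n M R i j 0) :
    carry R j = 1 ∧ cocarry n M R i < repeats R i j := by
  have hij' : i + 1 ≤ j := hij
  have hstep := hR.row_step (hij.trans_le hj)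
  have hle := hR.one_le_zero (v := i + 1) (hij.trans_le hj)
  have hlow := (dip_le_low hR hij' hj).1.trans (low_le_height_left hij')
  have hcarry := hR.carry_le_one hj
  have hcocarry := hR.cocarry_le_one (hij.trans_le hj).le
  have hcoeq := cocarry_of_eq (n := n) (hij.trans_le hj) hi
  have hbounds := hR.growth_bounds hij.le hj
  have hbounds' := hR.growth_bounds hij' hj
  have hcodip := hR.dip_add_cocarry_le hij' hj
  have hself : dip R (i + 1) (i + 1) = height R (i + 1) := dip_self
  rw [hR.flagGrowth_one_add_one_eq hij.le hj] at hadj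
  rw [dip_succ_left hR hij hj] at hadj hlt
  unfold height at *
  rcases hadj with ⟨-, rfl⟩ | ⟨h, h'⟩ <;> omega

theorem IsLattice.height_eq_iff_of_up (hR : IsLattice n 0 M R) (hij : i < j) (hj : j ≤ M)
    (hi : R i 0 < R (i + 1) 0) (hd : dip R (i + 1) j = height R (i + 1)) :
    height R j = height R (i + 1) ↔
      flagGrowth n M R i j 1 + 1 = flagGrowth n M R i j 0 ∧
        ¬ (carry R j = 1 ∧ cocarry n M R i < repeats R i j) := by
  have hij' : i + 1 ≤ j := hij
  have hstep := hR.row_step (hij.trans_le hj)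
  have hlow := (dip_le_low hR hij' hj).1.trans (low_le_height hij')
  have hcarry := hR.carry_le_one hj
  have hcocarry := hR.cocarry_step (n := n) (hij.trans_le hj)
  have hbounds := hR.growth_bounds hij.le hj
  have hbounds' := hR.growth_bounds hij' hj
  have hdip := hR.dip_add_carry_le hij' hj
  have hone := hR.one_add_dip_le hij.le hj
  have hmin : dip R i j = R i 0 - R (i + 1) 1 := by
    rw [dip_succ_left hR hij hj, hd, height]
    omega
  have hlej := hR.one_le_zero hj
  rw [hR.flagGrowth_one_add_one_eq hij.le hj]
  rw [hmin] at hone ⊢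
  rw [hd] at hlow hdip
  unfold height at *
  rcases lt_or_ge (repeats R i j) (carry R j + cocarry n M R i) with h | h
  · have : R j 1 = R (i + 1) 1 := by omega
    have : repeats R i j = cocarry n M R i := by omega
    omega
  · have hc : carry R j = 0 ∨ carry R j = 1 := by omega
    simp only [h.not_gt, h, false_and, true_and, false_or]
    rcases hc with hc | hc <;> rw [hc] at h hdip ⊢ <;> omega

theorem IsLattice.flagGrowth_first_row (hR : IsLattice n 0 M R) (hij : i < j) (hj : j < M) :
    flagGrowth n M R (i + 1) (j + 1) 0 < flagGrowth n M R i (j + 1) 0 ↔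
      flagGrowth n M R (i + 1) j 0 < flagGrowth n M R i j 0 ∧
        (flagGrowth n M R i j 0 < flagGrowth n M R i (j + 1) 0 ∨
          ¬ (flagGrowth n M R i j 1 + 1 = flagGrowth n M R i j 0 ∧
            flagGrowth n M R i j 1 < flagGrowth n M R i (j + 1) 1)) := by
  have hij' : i + 1 ≤ j := hij
  have hi := hR.row_step (hij.trans hj)
  have hflat := hR.carry_eq_one_of_flat hij hj.le
  have hup := hR.height_eq_iff_of_up hij hj.le
  have hlow := (dip_le_low hR hij' hj.le).1.trans (low_le_height hij')
  have hlow' := (dip_le_low hR hij' hj.le).1.trans (low_le_height_left hij')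
  have hheight : R j 1 < R (j + 1) 1 → R j 0 - R (j + 1) 1 = height R j - 1 := fun h => by
    have := hR.row_step hj
    rw [height]
    omega
  have hdip : R i 0 < R (i + 1) 0 → dip R (i + 1) j = height R (i + 1) →
      dip R i j + 1 ≤ height R (i + 1) := fun h hd => by
    have := hR.one_le_zero (v := i + 1) (hij.trans hj)
    rw [dip_succ_left hR hij hj.le, hd, height]
    omega
  rw [(hR.flagGrowth_hole_zero (Nat.lt_succ_of_lt hij) hj).2,
    (hR.flagGrowth_hole_zero hij hj.le).2, hR.flagGrowth_step_zero hij.le hj,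
    hR.flagGrowth_step_one hij.le hj, dip_succ hij']
  by_cases hsecond : R j 1 < R (j + 1) 1
  · simp only [hheight hsecond, hsecond, true_and]
    rcases hi.1.1.eq_or_lt with h | h
    · have := hflat h.symm
      clear hflat hup
      omega
    rcases hlow'.eq_or_lt with hd | hd
    · have hlt : dip R i j < height R j := by have := hdip h hd; omega
      simp only [h, hlt, hd, lt_irrefl, true_and, not_false_eq_true, not_true_eq_false, false_or]
      rw [← hup h hd]
      omega
    · simp [h, hd]
  · have : R j 0 - R (j + 1) 1 = height R j := by
      have := hR.row_step hj
      rw [height]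
      omega
    rw [this, min_eq_left hlow]
    simp [hsecond]

theorem IsLattice.repeats_le_cocarry (hR : IsLattice n 0 M R) (hij : i ≤ j) (hj : j ≤ M)
    (h : R j 1 + dip R i j ≤ R i 0) : repeats R i j ≤ cocarry n M R i := by
  induction hij using Nat.decreasingInduction with
  | self => simp [repeats]
  | of_succ i hij ih =>
    have hbounds := hR.growth_bounds (show i + 1 ≤ j from hij) hj
    have hbounds' := hR.growth_bounds hij.le hj
    have hstep := hR.row_step (hij.trans_le hj)
    have hcocarry := hR.cocarry_step (hij.trans_le hj)
    have hdip := hR.le_one_add_dip (show i + 1 ≤ j from hij) hj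
    rw [dip_succ_left hR hij hj] at h
    omega

theorem IsLattice.sum_flagGrowth (hR : IsLattice n 0 M R) (hij : i ≤ j) (hj : j ≤ M) :
    flagGrowth n M R i j 0 + flagGrowth n M R i j 1 + flagGrowth n M R i j 2 = j - i := by
  have hle := hR.flagGrowth_two_le hij hj
  simp only [flagGrowth, Matrix.cons_val] at hle ⊢
  omega

theorem IsLattice.carry_lt_repeats_succ_iff (hR : IsLattice n 0 M R) (hij : i ≤ j) (hj : j < M) :
    carry R (j + 1) < repeats R i (j + 1) ↔
      carry R j < repeats R i j ∨ R j 1 < R (j + 1) 1 ∧ carry R j = 1 ∧ repeats R i j = 1 := by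
  have hbounds := hR.growth_bounds hij hj.le
  have hbounds' := hR.growth_bounds (show i ≤ j + 1 by omega) hj
  have hcarry := hR.carry_step hj
  have hle := hR.carry_le_one hj.le
  have hstep := hR.row_step hj
  omega

theorem IsLattice.flagGrowth_new_column_iff (hR : IsLattice n 0 M R) (hij : i < j) (hj : j < M) :
    (flagGrowth n M R (i + 1) j 1 < flagGrowth n M R i j 1 ∧ flagGrowth n M R i j 1 = 1 ∧
      flagGrowth n M R i j 2 = 0 ∧ 0 < flagGrowth n M R i (j + 1) 2) ↔
    (R i 0 < R (i + 1) 0 ∧ cocarry n M R (i + 1) = 1) ∧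
      R j 1 < R (j + 1) 1 ∧ carry R j = 1 ∧ repeats R (i + 1) j = 1 := by
  have hij' : i + 1 ≤ j := hij
  have hcocarry := hR.cocarry_step (n := n) (hij.trans hj)
  have hone := hR.cocarry_le_one (i := i + 1) (hij.trans hj)
  have hi := hR.row_step (hij.trans hj)
  have hbounds := hR.growth_bounds hij.le hj.le
  have hbounds' := hR.growth_bounds hij' hj.le
  have hcodip := hR.dip_add_cocarry_le hij' hj.le
  have hempty := hR.one_add_dip_le hij' hj.le
  have hrepeats := hR.repeats_le_cocarry hij' hj.le
  have hdip := hR.le_one_add_dip hij' hj.le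
  have hrect := hR.rectGrowth_hole_one hij hj.le
  have hrow : rectGrowth R (i + 1) j 1 = R j 1 + dip R (i + 1) j - R (i + 1) 0 := rfl
  have hcolumn : 0 < flagGrowth n M R i (j + 1) 2 ∧ flagGrowth n M R i j 2 = 0 ↔
      R j 1 < R (j + 1) 1 ∧ carry R j = 1 ∧ repeats R i j = cocarry n M R i + 1 := by
    have hstep := hR.flagGrowth_step_two hij.le hj
    have htwo : flagGrowth n M R i j 2 = repeats R i j - carry R j - cocarry n M R i := rfl
    omega
  simp only [flagGrowth, Matrix.cons_val] at hcolumn ⊢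
  constructor
  · rintro ⟨hhole, hone_box, htwo, hpos⟩
    obtain ⟨hsecond, hcarry, heq⟩ := hcolumn.1 ⟨hpos, htwo⟩
    rw [htwo] at hone_box hhole
    have hle : repeats R (i + 1) j ≤ carry R j + cocarry n M R (i + 1) := by
      clear hrepeats hempty hcodip
      omega
    have hrow_empty : rectGrowth R (i + 1) j 1 = 0 := by omega
    have hfirst := (hrect.2.1 (by omega)).1
    have := hrepeats (by omega)
    omega
  · rintro ⟨⟨hfirst, hco⟩, hsecond, hcarry, heq⟩
    have hrow_empty := hempty (by omega)
    have hlow := hcodip (by omega)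
    have heq' : repeats R i j = cocarry n M R i + 1 := by omega
    have hhole := hrect.2.2 ⟨hfirst, by omega⟩
    have := hcolumn.2 ⟨hsecond, hcarry, heq'⟩
    omega

theorem IsLattice.flagGrowth_column (hR : IsLattice n 0 M R) (hij : i < j) (hj : j < M) :
    flagGrowth n M R (i + 1) (j + 1) 2 < flagGrowth n M R i (j + 1) 2 ↔
      flagGrowth n M R (i + 1) j 2 < flagGrowth n M R i j 2 ∨
        flagGrowth n M R (i + 1) j 1 < flagGrowth n M R i j 1 ∧ flagGrowth n M R i j 1 = 1 ∧
          flagGrowth n M R i j 2 = 0 ∧ 0 < flagGrowth n M R i (j + 1) 2 := by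
  have hij' : i + 1 ≤ j := hij
  rw [hR.flagGrowth_new_column_iff hij hj, (hR.flagGrowth_hole_two (j := j + 1) (by omega) hj).2,
    (hR.flagGrowth_hole_two hij hj.le).2, hR.carry_lt_repeats_succ_iff hij' hj]
  tauto

theorem LocalRule.of_sum {x x' y y' : Fin 3 → ℕ} (near : ∀ s, y s ≤ x s ∧ x s ≤ y s + 1)
    (near' : ∀ s, y' s ≤ x' s ∧ x' s ≤ y' s + 1) (sum : x 0 + x 1 + x 2 = y 0 + y 1 + y 2 + 1)
    (sum' : x' 0 + x' 1 + x' 2 = y' 0 + y' 1 + y' 2 + 1)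
    (step : x 1 < x' 1 → ¬ x 0 < x' 0 ∧ ¬ x 2 < x' 2)
    (first_row : y' 0 < x' 0 ↔ y 0 < x 0 ∧ (x 0 < x' 0 ∨ ¬ (x 1 + 1 = x 0 ∧ x 1 < x' 1)))
    (column : y' 2 < x' 2 ↔ y 2 < x 2 ∨ y 1 < x 1 ∧ x 1 = 1 ∧ x 2 = 0 ∧ 0 < x' 2) :
    LocalRule x x' y y' := by
  refine ⟨near', first_row, ?_, column⟩
  simp only [Fin.forall_fin_succ, Fin.isValue, Fin.succ_zero_eq_one, Fin.succ_one_eq_two,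
    IsEmpty.forall_iff, and_true] at near near'
  have hone : y 1 < x 1 ↔ ¬ y 0 < x 0 ∧ ¬ y 2 < x 2 := by omega
  have hone' : y' 1 < x' 1 ↔ ¬ y' 0 < x' 0 ∧ ¬ y' 2 < x' 2 := by omega
  have hdisj : y 0 < x 0 → ¬ y 2 < x 2 := by omega
  rw [hone', first_row, column, hone]
  clear near near' first_row column hone hone' sum sum'
  by_cases hlt : x 1 < x' 1
  · have hstep := step hlt
    have hnew : x 2 = 0 → ¬ 0 < x' 2 := by omega
    simp only [hlt, hstep, and_true, false_or, true_or]
    tauto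
  · simp only [hlt, and_false, not_false_eq_true, or_true, and_true, false_or, or_false]
    tauto

theorem IsLattice.localRule_flagGrowth (hR : IsLattice n 0 M R) (hij : i < j) (hj : j < M) :
    LocalRule (flagGrowth n M R i j) (flagGrowth n M R i (j + 1)) (flagGrowth n M R (i + 1) j)
      (flagGrowth n M R (i + 1) (j + 1)) := by
  have hij' : i + 1 ≤ j := hij
  have hnear : ∀ l ≤ M, i < l → ∀ s, flagGrowth n M R (i + 1) l s ≤ flagGrowth n M R i l s ∧
      flagGrowth n M R i l s ≤ flagGrowth n M R (i + 1) l s + 1 := fun l hl hil s =>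
    match s with
    | 0 => (hR.flagGrowth_hole_zero hil hl).1
    | 1 => hR.flagGrowth_hole_one hil hl
    | 2 => (hR.flagGrowth_hole_two hil hl).1
  refine .of_sum (hnear j hj.le hij) (hnear (j + 1) hj (by omega)) ?_ ?_ ?_
    (hR.flagGrowth_first_row hij hj) (hR.flagGrowth_column hij hj)
  · rw [hR.sum_flagGrowth hij.le hj.le, hR.sum_flagGrowth hij' hj.le]
    omega
  · rw [hR.sum_flagGrowth (by omega) hj, hR.sum_flagGrowth (by omega) hj]
    omega
  · rw [hR.flagGrowth_step_zero hij.le hj, hR.flagGrowth_step_one hij.le hj,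
      (hR.flagGrowth_step_two hij.le hj).2]
    tauto

theorem flagGrowth_self (hR : IsLattice n 0 M R) (hi : i ≤ M) : flagGrowth n M R i i = 0 := by
  have hrect := congrFun (rectGrowth_self hR hi) 1
  simp only [Pi.zero_apply] at hrect
  funext s
  match s with
  | 0 | 1 | 2 => simp [flagGrowth, hrect, repeats]

theorem IsLattice.zero_lt_succ_zero (hR : IsLattice n 0 M R) (hM : 0 < M) : R 0 0 < R 1 0 := by
  have := hR.row_step hM
  simp only [zero_add, hR.zero, Pi.zero_apply] at this ⊢
  omega

theorem IsLattice.cocarry_zero (hR : IsLattice n 0 M R) : cocarry n M R 0 = 0 := by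
  rcases M.eq_zero_or_pos with rfl | hM
  · rfl
  · have := hR.row_step hM
    rw [hR.cocarry_of_lt hM (hR.zero_lt_succ_zero hM)]
    simp only [zero_add, hR.zero, Pi.zero_apply] at this ⊢
    omega

theorem IsLattice.carry_last (hR : IsLattice n 0 M R) : carry R M = 0 := by
  rcases M with _ | M
  · rfl
  · have hstep := hR.row_step M.lt_succ_self
    have hcarry := hR.carry_step M.lt_succ_self
    have h0 : R (M + 1) 0 = n := congrFun hR.top 0
    have h1 : R (M + 1) 1 = n := congrFun hR.top 1
    omega

theorem flagGrowth_zero_left (hR : IsLattice n 0 M R) (hj : j ≤ M) :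
    flagGrowth n M R 0 j = flagCount R j := by
  simp [flagGrowth, flagCount, rectGrowth_zero_left hR hj, hR.cocarry_zero, repeats, hR.zero]

theorem flagGrowth_right (hR : IsLattice n 0 M R) (hv : v ≤ M) :
    flagGrowth n M R (M - v) M = flagCount (rotate n M R) v := by
  have hrepeats : repeats R (M - v) M = rotate n M R v 0 + rotate n M R v 1 - v := by
    have h0 : R M 0 = n := congrFun hR.top 0
    have h1 : R M 1 = n := congrFun hR.top 1
    have := hR.growth_bounds (M.sub_le v) le_rfl
    simp only [repeats, rotate, Matrix.cons_val]
    omega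
  rw [flagGrowth, flagCount, rectGrowth_right hR, hR.carry_last, cocarry, Nat.sub_sub_self hv,
    hrepeats, Nat.sub_zero]

end FlagGrowth

/-! ### Evacuation -/

section Evacuation

variable {n k M : ℕ} {S T : Filling} {R : ℕ → Fin 3 → ℕ}

theorem armCount_kEvacuation_rect (hn : 0 < n) (hT : IsIncreasing (flagShape n 0) M T) {v : ℕ}
    (hv : v ≤ M) :
    armCount n 0 (kEvacuation (flagShape n 0) T) v = rotate n M (armCount n 0 T) v := by
  have hR := hT.isLattice hn
  have hcount := armCount_kPromotion_iterate hn hT (a := rectGrowth (armCount n 0 T))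
    (fun j hj => rectGrowth_zero_left hR hj) (fun i hi => rectGrowth_self hR hi)
    (fun i j hij hj => hR.localRule_rectGrowth hij hj) (M.sub_le v) le_rfl
  rw [armCount_kEvacuation hn hT hv, ← rectGrowth_right hR, ← hcount, Nat.sub_sub_self hv]

theorem armCount_kEvacuation_flag (hk : k < n) (hS : IsIncreasing (flagShape n k) M S)
    (hR : IsLattice n 0 M R) (hcount : ∀ v ≤ M, armCount n k S v = flagCount R v) {v : ℕ}
    (hv : v ≤ M) :
    armCount n k (kEvacuation (flagShape n k) S) v = flagCount (rotate n M R) v := by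
  have hcount := armCount_kPromotion_iterate hk hS (a := flagGrowth n M R)
    (fun j hj => (flagGrowth_zero_left hR hj).trans (hcount j hj).symm)
    (fun i hi => flagGrowth_self hR hi) (fun i j hij hj => hR.localRule_flagGrowth hij hj)
    (M.sub_le v) le_rfl
  rw [armCount_kEvacuation hk hS hv, ← flagGrowth_right hR hv, ← hcount, Nat.sub_sub_self hv]

end Evacuation

/-! ### The flag tableau of a two-row tableau -/

section FlagCount

variable {n k M v : ℕ} {R N : ℕ → Fin 3 → ℕ}

theorem IsLattice.carry_bounds (hR : IsLattice n 0 M R) (hv : v ≤ M) :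
    (R v 0 ≤ v ∧ R v 1 + carry R v ≤ R v 0 ∧ v + carry R v ≤ R v 0 + R v 1) ∧
      (0 < R v 1 → R v 0 < v + carry R v) := by
  induction v with
  | zero => simp [hR.zero, carry]
  | succ v ih =>
    have := ih (by omega)
    have := hR.row_step hv
    have := hR.carry_step hv
    omega

theorem IsLattice.flagCount_step (hR : IsLattice n 0 M R) (hv : v < M) :
    (R (v + 1) 1 = R v 1 ∧ flagCount R (v + 1) 0 = flagCount R v 0 + 1 ∧
      flagCount R (v + 1) 1 = flagCount R v 1 ∧ flagCount R (v + 1) 2 = flagCount R v 2) ∨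
    (R (v + 1) 1 = R v 1 + 1 ∧ carry R v = 0 ∧ flagCount R (v + 1) 0 = flagCount R v 0 ∧
      flagCount R (v + 1) 1 = flagCount R v 1 + 1 ∧ flagCount R (v + 1) 2 = flagCount R v 2) ∨
    (R (v + 1) 1 = R v 1 + 1 ∧ carry R v = 1 ∧ flagCount R (v + 1) 0 = flagCount R v 0 ∧
      flagCount R (v + 1) 1 = flagCount R v 1 ∧
      flagCount R (v + 1) 2 = flagCount R v 2 + 1) := by
  have hbounds := hR.carry_bounds hv.le
  have hbounds' := hR.carry_bounds (v := v + 1) hv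
  have hle := hR.carry_le_one hv.le
  have hstep := hR.row_step hv
  have hcarry := hR.carry_step hv
  simp only [flagCount, Matrix.cons_val]
  omega

theorem IsLattice.sum_flagCount (hR : IsLattice n 0 M R) (hv : v ≤ M) :
    ∑ s, flagCount R v s = v := by
  have := hR.carry_bounds hv
  simp only [flagCount, Fin.sum_univ_three, Matrix.cons_val]
  omega

theorem isLattice_flagCount (hR : IsLattice n 0 M R) (hM : M + k = 2 * n) :
    IsLattice n k M (flagCount R) where
  zero := by
    funext s
    match s with
    | 0 | 1 | 2 => simp [flagCount, hR.zero]
  top := by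
    have h0 : R M 0 = n := congrFun hR.top 0
    have h1 : R M 1 = n := congrFun hR.top 1
    have := hR.carry_bounds le_rfl
    funext s
    match s with
    | 0 | 1 | 2 =>
      simp only [flagCount, armLen, h0, h1, hR.carry_last, Matrix.cons_val]
      omega
  mono v hv s := by
    have := hR.flagCount_step hv
    match s with
    | 0 | 1 | 2 => omega
  step v hv s := by
    have := hR.flagCount_step hv
    match s with
    | 0 | 1 | 2 => omega
  cover v hv := by
    by_contra! hle
    have := Finset.sum_le_sum fun s (_ : s ∈ Finset.univ) => hle s
    rw [hR.sum_flagCount hv, hR.sum_flagCount hv.le] at this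
    omega
  below v hv := by
    have hbounds := hR.carry_bounds hv.le
    have hcarry := hR.carry_step hv
    have hstep := hR.row_step hv
    simp only [flagCount, Matrix.cons_val]
    omega
  column v hv h := by
    have hbounds := hR.carry_bounds hv.le
    have hcarry := hR.carry_step hv
    have hstep := hR.row_step hv
    simp only [flagCount, Matrix.cons_val] at h ⊢
    omega

/-- `1` if the first label greater than `v` outside the first row of a flag tableau with arm counts
`N` lies below the second row, and `0` otherwise; this recovers `carry` from the flag tableau. -/
def lookahead (M : ℕ) (N : ℕ → Fin 3 → ℕ) (v : ℕ) : ℕ :=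
  if v < M then
    if N v 0 < N (v + 1) 0 then lookahead M N (v + 1) else N (v + 1) 2 - N v 2
  else 0
termination_by M - v

/-- The inverse of `flagCount`. -/
def unflagCount (M : ℕ) (N : ℕ → Fin 3 → ℕ) (v : ℕ) : Fin 3 → ℕ :=
  ![N v 0 + N v 2 + lookahead M N v, N v 1 + N v 2, 0]

theorem lookahead_self : lookahead M N M = 0 := by simp [lookahead]

theorem lookahead_of_lt (hv : v < M) (h : N v 0 < N (v + 1) 0) :
    lookahead M N v = lookahead M N (v + 1) := by rw [lookahead, if_pos hv, if_pos h]

theorem lookahead_of_le (hv : v < M) (h : N (v + 1) 0 ≤ N v 0) :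
    lookahead M N v = N (v + 1) 2 - N v 2 := by rw [lookahead, if_pos hv, if_neg h.not_gt]

theorem IsLattice.lookahead_flagCount (hR : IsLattice n 0 M R) (hv : v ≤ M) :
    lookahead M (flagCount R) v = carry R v := by
  induction hv using Nat.decreasingInduction with
  | self => rw [lookahead_self, hR.carry_last]
  | of_succ v hv ih =>
    have hstep := hR.flagCount_step hv
    have hle := hR.carry_le_one hv.le
    have hcarry := hR.carry_step hv
    by_cases h : R v 1 < R (v + 1) 1
    · rw [lookahead_of_le hv (by omega)]
      omega
    · rw [lookahead_of_lt hv (by omega), ih]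
      omega

theorem IsLattice.unflagCount_flagCount (hR : IsLattice n 0 M R) (hv : v ≤ M) :
    unflagCount M (flagCount R) v = R v := by
  have := hR.carry_bounds hv
  funext s
  match s with
  | 0 | 1 =>
    simp only [unflagCount, hR.lookahead_flagCount hv, flagCount, Matrix.cons_val]
    omega
  | 2 => exact (hR.column_eq_zero hv).symm

theorem IsLattice.arm_step (hN : IsLattice n k M N) (hsum : ∀ v ≤ M, ∑ s, N v s = v) (hv : v < M) :
    N v 0 + N v 1 + N v 2 = v ∧ N (v + 1) 0 + N (v + 1) 1 + N (v + 1) 2 = v + 1 ∧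
      N v 0 ≤ N (v + 1) 0 ∧ N v 1 ≤ N (v + 1) 1 ∧ N v 2 ≤ N (v + 1) 2 := by
  have h := hsum v hv.le
  have h' := hsum (v + 1) hv
  rw [Fin.sum_univ_three] at h h'
  exact ⟨h, h', hN.mono v hv 0, hN.mono v hv 1, hN.mono v hv 2⟩

theorem IsLattice.lookahead_zero (hN : IsLattice n k M N) (hsum : ∀ v ≤ M, ∑ s, N v s = v)
    (hv : v ≤ M) (h : N v 1 = 0) : lookahead M N v = 0 := by
  induction hv using Nat.decreasingInduction with
  | self => exact lookahead_self
  | of_succ v hv ih =>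
    have := hN.arm_step hsum hv
    have := hN.column v hv
    rcases lt_or_ge (N v 0) (N (v + 1) 0) with hlt | hle
    · rw [lookahead_of_lt hv hlt, ih (by omega)]
    · rw [lookahead_of_le hv hle]
      omega

theorem IsLattice.lookahead_step (hN : IsLattice n k M N) (hsum : ∀ v ≤ M, ∑ s, N v s = v)
    (hv : v < M) :
    (N v 0 < N (v + 1) 0 ∧ lookahead M N v = lookahead M N (v + 1)) ∨
      N (v + 1) 0 = N v 0 ∧ lookahead M N v + N v 2 = N (v + 1) 2 := by
  have := hN.arm_step hsum hv
  rcases lt_or_ge (N v 0) (N (v + 1) 0) with hlt | hle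
  · exact .inl ⟨hlt, lookahead_of_lt hv hlt⟩
  · rw [lookahead_of_le hv hle]
    omega

theorem IsLattice.lookahead_le_one (hN : IsLattice n k M N) (hsum : ∀ v ≤ M, ∑ s, N v s = v)
    (hv : v ≤ M) : lookahead M N v ≤ 1 := by
  induction hv using Nat.decreasingInduction with
  | self => exact lookahead_self.trans_le zero_le_one
  | of_succ v hv ih =>
    have := hN.arm_step hsum hv
    have := hN.lookahead_step hsum hv
    omega

theorem isLattice_unflagCount (hN : IsLattice n k M N) (hsum : ∀ v ≤ M, ∑ s, N v s = v)
    (hk : k < n) : IsLattice n 0 M (unflagCount M N) := by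
  have hstep := fun v (hv : v < M) => And.intro (hN.arm_step hsum hv)
    (And.intro (hN.lookahead_step hsum hv) (hN.lookahead_le_one hsum (v := v + 1) hv))
  refine ⟨?_, ?_, fun v hv s => ?_, fun v hv s => ?_, fun v hv => ?_, fun v hv => ?_,
    fun _ _ h => ?_⟩
  · simp [unflagCount, hN.zero, hN.lookahead_zero hsum M.zero_le]
  · simp [unflagCount, hN.top, lookahead_self, armLen, Nat.sub_add_cancel hk.le]
  · have := hstep v hv
    match s with
    | 0 | 1 | 2 =>
      simp only [unflagCount, Matrix.cons_val]
      omega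
  · have := hstep v hv
    match s with
    | 0 | 1 | 2 =>
      simp only [unflagCount, Matrix.cons_val]
      omega
  · have := hstep v hv
    rcases lt_or_ge (N v 0) (N (v + 1) 0) with hlt | hle
    · refine ⟨0, ?_⟩
      simp only [unflagCount, Matrix.cons_val]
      omega
    · refine ⟨1, ?_⟩
      simp only [unflagCount, Matrix.cons_val]
      omega
  · have := hstep v hv
    have := hN.below v hv
    simp only [unflagCount, Matrix.cons_val]
    omega
  · simp [unflagCount] at h

theorem IsLattice.carry_unflagCount (hN : IsLattice n k M N) (hsum : ∀ v ≤ M, ∑ s, N v s = v)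
    (hk : k < n) (hv : v ≤ M) : carry (unflagCount M N) v = lookahead M N v := by
  have hU := isLattice_unflagCount hN hsum hk
  induction v with
  | zero => exact (hN.lookahead_zero hsum M.zero_le (by simp [hN.zero])).symm
  | succ v ih =>
    have := hN.arm_step hsum hv
    have := hN.lookahead_step hsum hv
    have := ih (by omega)
    have hcarry := hU.carry_step hv
    simp only [unflagCount, Matrix.cons_val] at hcarry this ⊢
    omega

theorem IsLattice.flagCount_unflagCount (hN : IsLattice n k M N) (hsum : ∀ v ≤ M, ∑ s, N v s = v)
    (hk : k < n) (hv : v ≤ M) : flagCount (unflagCount M N) v = N v := by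
  have hcarry := hN.carry_unflagCount hsum hk hv
  have := hsum v hv
  rw [Fin.sum_univ_three] at this
  funext s
  rw [flagCount, hcarry]
  match s with
  | 0 | 1 | 2 =>
    simp only [unflagCount, Matrix.cons_val]
    omega

end FlagCount

/-! ### The arm counts of the flag tableau -/

theorem countP_le_eq_zero {l : List ℕ} {v : ℕ} (h : ∀ x ∈ l, v < x) : l.countP (· ≤ v) = 0 :=
  List.countP_eq_zero.2 fun x hx => by simpa using h x hx

theorem lt_countP_le_iff {l : List ℕ} (hl : l.Pairwise (· < ·)) {c v : ℕ} :
    c < l.countP (· ≤ v) ↔ c < l.length ∧ l.getD c 0 ≤ v := by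
  induction l generalizing c with
  | nil => simp
  | cons a l ih =>
    obtain ⟨ha, hl⟩ := List.pairwise_cons.1 hl
    rcases le_or_gt a v with hav | hva
    · rw [List.countP_cons_of_pos (by simpa using hav)]
      rcases c with _ | c
      · simp [hav]
      · simpa using ih hl
    · have hlt : ∀ x ∈ a :: l, v < x := by simpa using ⟨hva, fun x hx => hva.trans (ha x hx)⟩
      rw [countP_le_eq_zero hlt]
      refine iff_of_false (Nat.not_lt_zero c) ?_
      rintro ⟨hc, hle⟩
      rw [List.getD_eq_getElem _ _ hc] at hle
      exact hle.not_gt (hlt _ (List.getElem_mem hc))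

theorem countP_le_succ {l : List ℕ} (hl : l.Nodup) (v : ℕ) :
    l.countP (· ≤ v + 1) = l.countP (· ≤ v) + if v + 1 ∈ l then 1 else 0 := by
  rw [← hl.count]
  induction l with
  | nil => rfl
  | cons a l ih =>
    simp only [List.countP_cons, List.count_cons, ih hl.of_cons, decide_eq_true_eq, beq_iff_eq]
    split_ifs <;> omega

theorem countP_le_eq {l : List ℕ} (hl : l.Nodup) {f : ℕ → ℕ} {M : ℕ} (hf : f 0 = 0)
    (hpos : ∀ x ∈ l, 0 < x) (hstep : ∀ v < M, f v ≤ f (v + 1) ∧ f (v + 1) ≤ f v + 1)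
    (hmem : ∀ v < M, (v + 1 ∈ l ↔ f v < f (v + 1))) {v : ℕ} (hv : v ≤ M) :
    l.countP (· ≤ v) = f v := by
  induction v with
  | zero => rw [hf, countP_le_eq_zero hpos]
  | succ v ih =>
    have := hstep v hv
    rw [countP_le_succ hl, ih (by omega)]
    split_ifs with h
    · have := (hmem v hv).1 h
      omega
    · have := mt (hmem v hv).2 h
      omega

/-- The labels of `flagMap n T` in each arm, in the coordinates of `box`. -/
def flagArm (n : ℕ) (T : Filling) : Fin 3 → List ℕ :=
  ![(rowList n T 0).filter (· ∉ setA n T), (rowList n T 1).filter (· ∉ setB n T),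
    (setB n T).sort (· ≤ ·)]

theorem flagMap_box {n : ℕ} {T : Filling} (s : Fin 3) (c : ℕ) :
    flagMap n T (box s c) = (flagArm n T s).getD c 0 := by
  fin_cases s <;> simp [flagMap, flagArm, box]

theorem flagMap_eq_zero {n k : ℕ} {T : Filling} (hk : k < n)
    (hlen : ∀ s, (flagArm n T s).length = armLen n k s) {b : ℕ × ℕ} (hb : b ∉ flagShape n k) :
    flagMap n T b = 0 := by
  by_cases hbox : ∃ s c, b = box s c
  · obtain ⟨s, c, rfl⟩ := hbox
    rw [flagMap_box, List.getD_eq_default _ _ ?_]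
    rw [hlen]
    exact not_lt.1 (mt (box_mem_flagShape hk).2 hb)
  · have hrow : 2 ≤ b.1 ∧ b.2 ≠ 0 := by
      by_contra! h
      refine hbox ?_
      obtain ⟨r, c⟩ := b
      match r with
      | 0 => exact ⟨0, c, rfl⟩
      | 1 => exact ⟨1, c, rfl⟩
      | r + 2 => exact ⟨2, r, Prod.ext rfl (h (Nat.le_add_left 2 r))⟩
    rw [flagMap, if_neg (by omega), if_neg (by omega), if_neg hrow.2]

section FlagMap

variable {n k M v c : ℕ} {T : Filling} {s : Fin 3}

theorem box_of_ne_two (hs : s ≠ 2) : box s c = (s.1, c) := by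
  fin_cases s
  · rfl
  · rfl
  · exact absurd rfl hs

theorem armLen_of_ne_two (hs : s ≠ 2) : armLen n 0 s = n := by
  fin_cases s
  · rfl
  · rfl
  · exact absurd rfl hs

theorem mem_rowList (hs : s ≠ 2) : v ∈ rowList n T s ↔ ∃ c < n, T (box s c) = v := by
  simp [rowList, box_of_ne_two hs]

theorem IsIncreasing.succ_mem_rowList_iff (hn : 0 < n) (hT : IsIncreasing (flagShape n 0) M T)
    (hs : s ≠ 2) : v + 1 ∈ rowList n T s ↔ armCount n 0 T v s < armCount n 0 T (v + 1) s := by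
  rw [mem_rowList hs]
  constructor
  · rintro ⟨c, -, hc⟩
    have := (hT.box_eq_iff hn).1 hc
    omega
  · refine fun hlt => ⟨_, ?_, (hT.box_eq_iff hn).2 ⟨le_rfl, hlt⟩⟩
    exact (hlt.trans_le armCount_le_armLen).trans_eq (armLen_of_ne_two hs)

theorem IsIncreasing.pairwise_rowList (hn : 0 < n) (hT : IsIncreasing (flagShape n 0) M T)
    (hs : s ≠ 2) : (rowList n T s).Pairwise (· < ·) := by
  refine List.isChain_iff_pairwise.1 ((List.isChain_map _).2 ?_)
  refine (List.isChain_range _ _).2 fun c hc => ?_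
  rw [← box_of_ne_two hs, ← box_of_ne_two hs]
  exact hT.box_lt hn (.inl ⟨rfl, rfl⟩) (by rw [armLen_of_ne_two hs]; omega)

theorem IsIncreasing.succ_mem_setA_iff (hn : 0 < n) (hT : IsIncreasing (flagShape n 0) M T) :
    v + 1 ∈ setA n T ↔ armCount n 0 T v 0 < armCount n 0 T (v + 1) 0 ∧
      armCount n 0 T v 1 < armCount n 0 T (v + 1) 1 := by
  rw [setA, Finset.mem_inter, List.mem_toFinset, List.mem_toFinset]
  exact and_congr (hT.succ_mem_rowList_iff hn (s := 0) (by decide))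
    (hT.succ_mem_rowList_iff hn (s := 1) (by decide))

theorem IsIncreasing.carry_eq_one_iff (hn : 0 < n) (hT : IsIncreasing (flagShape n 0) M T)
    (hv : v ≤ M) :
    carry (armCount n 0 T) v = 1 ↔ ∃ c, armCount n 0 T v 1 = c + 1 ∧ T (1, c) ∈ setA n T := by
  have hR := hT.isLattice hn
  induction v with
  | zero => simp [carry, hR.zero]
  | succ v ih =>
    have hstep := hR.row_step hv
    rcases hstep.2.1.1.eq_or_lt with heq | hlt
    · simp only [carry_succ_of_eq heq.symm, ih (Nat.le_of_lt hv), heq]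
    · have hlast : T (1, armCount n 0 T v 1) = v + 1 :=
        (hT.box_eq_iff hn (s := 1)).2 ⟨le_rfl, hlt⟩
      have hsucc : armCount n 0 T (v + 1) 1 = armCount n 0 T v 1 + 1 := by omega
      simp only [hsucc, Nat.add_right_cancel_iff, exists_eq_left', hlast,
        hT.succ_mem_setA_iff hn, carry_succ_of_lt hlt]
      omega

theorem IsIncreasing.succ_mem_setB_iff (hn : 0 < n) (hT : IsIncreasing (flagShape n 0) M T)
    (hv : v < M) :
    v + 1 ∈ setB n T ↔ armCount n 0 T v 1 < armCount n 0 T (v + 1) 1 ∧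
      carry (armCount n 0 T) v = 1 := by
  have hR := hT.isLattice hn
  have hstep := hR.row_step hv
  have hbox : ∀ c, T (1, c) = v + 1 ↔ armCount n 0 T v 1 ≤ c ∧ c < armCount n 0 T (v + 1) 1 :=
    fun c => hT.box_eq_iff hn (s := 1)
  have hlen : armCount n 0 T (v + 1) 1 ≤ n := hR.le_armLen (s := 1) hv
  simp only [setB, Finset.mem_image, Finset.mem_filter, Finset.mem_range, hbox,
    hT.carry_eq_one_iff hn hv.le]
  constructor
  · rintro ⟨c, ⟨-, -, hc⟩, hle, hlt⟩
    exact ⟨by omega, c, by omega, hc⟩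
  · rintro ⟨hlt, c, heq, hc⟩
    exact ⟨c, ⟨by omega, by omega, hc⟩, by omega, by omega⟩

theorem IsIncreasing.pairwise_flagArm (hn : 0 < n) (hT : IsIncreasing (flagShape n 0) M T) :
    (flagArm n T s).Pairwise (· < ·) := by
  match s with
  | 0 => exact (hT.pairwise_rowList hn (s := 0) (by decide)).filter _
  | 1 => exact (hT.pairwise_rowList hn (s := 1) (by decide)).filter _
  | 2 => exact (setB n T).sortedLT_sort.pairwise

theorem exists_mem_rowList_of_mem_flagArm (hv : v ∈ flagArm n T s) :
    ∃ s' : Fin 3, s' ≠ 2 ∧ v ∈ rowList n T s' := by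
  match s with
  | 0 => exact ⟨0, by decide, List.mem_of_mem_filter hv⟩
  | 1 => exact ⟨1, by decide, List.mem_of_mem_filter hv⟩
  | 2 =>
    have hB : v ∈ setB n T := (Finset.mem_sort (· ≤ ·)).1 hv
    obtain ⟨c, hc, rfl⟩ := Finset.mem_image.1 hB
    exact ⟨1, by decide, (mem_rowList (by decide)).2 ⟨c + 1, (Finset.mem_filter.1 hc).2.1, rfl⟩⟩

theorem IsIncreasing.flagArm_bounds (hn : 0 < n) (hT : IsIncreasing (flagShape n 0) M T)
    (hv : v ∈ flagArm n T s) : 0 < v ∧ v ≤ M := by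
  obtain ⟨s', hs', hv⟩ := exists_mem_rowList_of_mem_flagArm hv
  obtain ⟨c, hc, rfl⟩ := (mem_rowList hs').1 hv
  have hb := (box_mem_flagShape hn).2 (hc.trans_eq (armLen_of_ne_two hs').symm)
  exact ⟨hT.pos _ hb, hT.le _ hb⟩

theorem IsIncreasing.succ_mem_flagArm_iff (hn : 0 < n) (hT : IsIncreasing (flagShape n 0) M T)
    (hv : v < M) : v + 1 ∈ flagArm n T s ↔
      flagCount (armCount n 0 T) v s < flagCount (armCount n 0 T) (v + 1) s := by
  have hR := hT.isLattice hn
  have hrow := hR.row_step hv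
  have hstep := hR.flagCount_step hv
  have hrow0 : v + 1 ∈ rowList n T 0 ↔ _ := hT.succ_mem_rowList_iff hn (s := 0) (by decide)
  have hrow1 : v + 1 ∈ rowList n T 1 ↔ _ := hT.succ_mem_rowList_iff hn (s := 1) (by decide)
  match s with
  | 0 =>
    simp only [flagArm, Matrix.cons_val, List.mem_filter, decide_eq_true_eq, hrow0,
      hT.succ_mem_setA_iff hn]
    omega
  | 1 =>
    simp only [flagArm, Matrix.cons_val, List.mem_filter, decide_eq_true_eq, hrow1,
      hT.succ_mem_setB_iff hn hv]
    omega
  | 2 =>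
    simp only [flagArm, Matrix.cons_val, Finset.mem_sort, hT.succ_mem_setB_iff hn hv]
    omega

theorem IsIncreasing.countP_flagArm (hn : 0 < n) (hT : IsIncreasing (flagShape n 0) M T)
    (hv : v ≤ M) : (flagArm n T s).countP (· ≤ v) = flagCount (armCount n 0 T) v s := by
  have hR := hT.isLattice hn
  refine countP_le_eq (hT.pairwise_flagArm hn).nodup ?_ (fun x hx => (hT.flagArm_bounds hn hx).1)
    (fun v hv => ?_) (fun v hv => hT.succ_mem_flagArm_iff hn hv) hv
  · match s with
    | 0 | 1 | 2 => simp [flagCount, hR.zero]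
  · have := hR.flagCount_step hv
    match s with
    | 0 | 1 | 2 => omega

theorem IsIncreasing.length_flagArm (hn : 0 < n) (hT : IsIncreasing (flagShape n 0) M T)
    (hM : M + k = 2 * n) : (flagArm n T s).length = armLen n k s := by
  rw [← (isLattice_flagCount (hT.isLattice hn) hM).top, ← hT.countP_flagArm hn le_rfl]
  exact (List.countP_eq_length.2 fun x hx => by simpa using (hT.flagArm_bounds hn hx).2).symm

theorem IsIncreasing.flagMap_box_le_iff (hn : 0 < n) (hT : IsIncreasing (flagShape n 0) M T)
    (hM : M + k = 2 * n) (hc : c < armLen n k s) (hv : v ≤ M) :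
    flagMap n T (box s c) ≤ v ↔ c < flagCount (armCount n 0 T) v s := by
  rw [flagMap_box, ← hT.countP_flagArm hn hv, lt_countP_le_iff (hT.pairwise_flagArm hn),
    hT.length_flagArm hn hM, and_iff_right hc]

theorem isIncreasing_flagMap (hk : k < n) (hT : IsIncreasing (flagShape n 0) M T)
    (hM : M + k = 2 * n) : IsIncreasing (flagShape n k) M (flagMap n T) := by
  have hn := Nat.zero_lt_of_lt hk
  exact (isLattice_flagCount (hT.isLattice hn) hM).isIncreasing hk
    (fun b hb => flagMap_eq_zero hk (fun s => hT.length_flagArm hn hM) hb)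
    fun s c hc v hv => hT.flagMap_box_le_iff hn hM hc hv

theorem armCount_flagMap (hn : 0 < n) (hT : IsIncreasing (flagShape n 0) M T)
    (hM : M + k = 2 * n) (hv : v ≤ M) :
    armCount n k (flagMap n T) v = flagCount (armCount n 0 T) v :=
  funext fun _ => armCount_eq_of_forall_iff
    ((isLattice_flagCount (hT.isLattice hn) hM).le_armLen hv)
    fun _ hc => hT.flagMap_box_le_iff hn hM hc hv

end FlagMap

/-! ### Bijectivity and compatibility with evacuation -/

section FlagMapEvacuation

variable {n k M v : ℕ} {T : Filling} {R R' N N' : ℕ → Fin 3 → ℕ}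

theorem carry_congr (h : ∀ w ≤ v, R w = R' w) : carry R v = carry R' v := by
  induction v with
  | zero => rfl
  | succ v ih =>
    rw [carry, carry, ih fun w hw => h w (by omega), h (v + 1) le_rfl, h v v.le_succ]

theorem flagCount_congr (h : ∀ w ≤ v, R w = R' w) : flagCount R v = flagCount R' v := by
  rw [flagCount, flagCount, carry_congr h, h v le_rfl]

theorem lookahead_congr (h : ∀ w ≤ M, N w = N' w) (hv : v ≤ M) :
    lookahead M N v = lookahead M N' v := by
  induction hv using Nat.decreasingInduction with
  | self => rw [lookahead_self, lookahead_self]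
  | of_succ v hv ih =>
    rw [lookahead.eq_def M N v, lookahead.eq_def M N' v, ih, h (v + 1) hv, h v hv.le]

theorem unflagCount_congr (h : ∀ w ≤ M, N w = N' w) (hv : v ≤ M) :
    unflagCount M N v = unflagCount M N' v := by
  rw [unflagCount, unflagCount, lookahead_congr h hv, h v hv]

theorem card_rect_two (n : ℕ) : (rect 2 n).card = 2 * n := by
  simp [YoungDiagram.card, rect]

theorem sum_armLen (hM : M + k = 2 * n) (hk : k < n) : M = ∑ s, armLen n k s := by
  simp only [Fin.sum_univ_three, armLen, Matrix.cons_val]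
  omega

theorem flagMap_injOn (hn : 0 < n) (hM : M + k = 2 * n) :
    Set.InjOn (flagMap n) {T | IsIncreasing (flagShape n 0) M T} := by
  intro T hT T' hT' heq
  refine hT.ext_armCount hn hT' fun v hv => ?_
  rw [← (hT.isLattice hn).unflagCount_flagCount hv, ← (hT'.isLattice hn).unflagCount_flagCount hv]
  refine unflagCount_congr (fun w hw => ?_) hv
  rw [← armCount_flagMap hn hT hM hw, heq, armCount_flagMap hn hT' hM hw]

theorem exists_flagMap_eq (hk : k < n) (hM : M + k = 2 * n)
    {S : Filling} (hS : IsIncreasing (flagShape n k) M S) :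
    ∃ T, IsIncreasing (flagShape n 0) M T ∧ flagMap n T = S := by
  have hn := Nat.zero_lt_of_lt hk
  have hN := hS.isLattice hk
  have hsum := fun v (hv : v ≤ M) => hN.sum_eq (sum_armLen hM hk) hv
  obtain ⟨T, hT, hcount⟩ := (isLattice_unflagCount hN hsum hk).exists_isIncreasing hn
  refine ⟨T, hT, (isIncreasing_flagMap hk hT hM).ext_armCount hk hS fun v hv => ?_⟩
  rw [armCount_flagMap hn hT hM hv, flagCount_congr fun w hw => hcount w (hw.trans hv),
    hN.flagCount_unflagCount hsum hk hv]

theorem IsIncreasing.lt_bound (hn : 0 < n) (hT : IsIncreasing (flagShape n 0) M T) : n < M := by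
  have hR := hT.isLattice hn
  have hbounds := hR.carry_bounds le_rfl
  have h0 : armCount n 0 T M 0 = n := congrFun hR.top 0
  have h1 : armCount n 0 T M 1 = n := congrFun hR.top 1
  rw [hR.carry_last, h0, h1] at hbounds
  omega

theorem flagMap_zero : flagMap 0 T = 0 := by
  funext b
  simp [flagMap, rowList, setB]

theorem evacuationVia_flagShape_zero {P : Filling → Filling} :
    evacuationVia P (flagShape 0 k) T = 0 :=
  funext fun _ => evacuationVia_eq_zero (by simp [mem_flagShape])

theorem evacuation_flagMap (hT : IsIncreasing (flagShape n 0) M T) (hM : M + k = 2 * n) :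
    evacuation (flagShape n k) (flagMap n T) = kEvacuation (flagShape n k) (flagMap n T) := by
  rcases n.eq_zero_or_pos with rfl | hn
  · rw [evacuation, kEvacuation, evacuationVia_flagShape_zero, evacuationVia_flagShape_zero]
  · have hk : k < n := by have := hT.lt_bound hn; omega
    have hS := isIncreasing_flagMap hk hT hM
    rw [sum_armLen hM hk, ← card_flagShape hk] at hS
    exact hS.evacuation_eq_kEvacuation

theorem kEvacuation_flagMap (hT : IsIncreasing (flagShape n 0) M T) (hM : M + k = 2 * n) :
    kEvacuation (flagShape n k) (flagMap n T) = flagMap n (kEvacuation (flagShape n 0) T) := by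
  rcases n.eq_zero_or_pos with rfl | hn
  · rw [flagMap_zero, flagMap_zero, kEvacuation, evacuationVia_flagShape_zero]
  · have hk : k < n := by have := hT.lt_bound hn; omega
    have hR := hT.isLattice hn
    have hS := isIncreasing_flagMap hk hT hM
    refine hS.kEvacuation.ext_armCount hk (isIncreasing_flagMap hk hT.kEvacuation hM) fun v hv => ?_
    rw [armCount_kEvacuation_flag hk hS hR (fun w hw => armCount_flagMap hn hT hM hw) hv,
      armCount_flagMap hn hT.kEvacuation hM hv]
    exact flagCount_congr fun w hw => (armCount_kEvacuation_rect hn hT (hw.trans hv)).symm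

theorem mem_inc_rect_two_iff (hM : M + k = 2 * n) :
    T ∈ Inc (rect 2 n) k ↔ IsIncreasing (flagShape n 0) M T := by
  rw [mem_inc_iff (hM.trans (card_rect_two n).symm), rect_two_eq_flagShape]

theorem mem_SYT_flagShape_iff (hk : k < n) (hM : M + k = 2 * n) :
    T ∈ SYT (flagShape n k) ↔ IsIncreasing (flagShape n k) M T := by
  rw [mem_SYT_iff, card_flagShape hk, ← sum_armLen hM hk]

theorem bijOn_flagMap (hk : k < n) :
    Set.BijOn (flagMap n) (Inc (rect 2 n) k) (SYT (flagShape n k)) := by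
  obtain ⟨M, hM⟩ : ∃ M, M + k = 2 * n := ⟨2 * n - k, by omega⟩
  have hn := Nat.zero_lt_of_lt hk
  refine ⟨fun T hT => ?_, fun T hT T' hT' heq => ?_, fun S hS => ?_⟩
  · exact (mem_SYT_flagShape_iff hk hM).2
      (isIncreasing_flagMap hk ((mem_inc_rect_two_iff hM).1 hT) hM)
  · exact flagMap_injOn hn hM ((mem_inc_rect_two_iff hM).1 hT) ((mem_inc_rect_two_iff hM).1 hT') heq
  · obtain ⟨T, hT, rfl⟩ := exists_flagMap_eq hk hM ((mem_SYT_flagShape_iff hk hM).1 hS)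
    exact ⟨T, (mem_inc_rect_two_iff hM).2 hT, rfl⟩

end FlagMapEvacuation

end IncTableau

theorem mainTheorem6 (n k : ℕ) :
    (k < n → Set.BijOn (flagMap n) (Inc (rect 2 n) k) (SYT (flagShape n k))) ∧
    ∀ T ∈ Inc (rect 2 n) k,
      kEvacuation (rect 2 n) T ∈ Inc (rect 2 n) k ∧
      evacuation (flagShape n k) (flagMap n T) = flagMap n (kEvacuation (rect 2 n) T) ∧
      kEvacuation (flagShape n k) (flagMap n T) = flagMap n (kEvacuation (rect 2 n) T) := by
  refine ⟨bijOn_flagMap, fun T hT => ?_⟩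
  obtain ⟨M, hM⟩ : ∃ M, M + k = 2 * n := ⟨_, hT.2.2.2.trans (card_rect_two n)⟩
  have hincr := (mem_inc_rect_two_iff hM).1 hT
  have hcomm := kEvacuation_flagMap hincr hM
  rw [mem_inc_rect_two_iff hM, rect_two_eq_flagShape]
  exact ⟨hincr.kEvacuation, (evacuation_flagMap hincr hM).trans hcomm, hcomm⟩
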